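/- Consider a chain of $n$ nodes $1,\dots,n$, each of which is either off or on, all off at time $0$. A node that is off switches on (recovers) after an exponentially distributed time with mean $1$; the lengths of all off-periods, of all nodes, are independent. The input is permanent: whenever the rightmost node $n$ recovers, it immediately receives a signal. A signal received by node $n$ at time $t$ is instantaneously passed on to the left through all nodes $n-1,n-2,\dots$ that are on just before time $t$, up to the first node that is off, and every node that receives the signal is switched off at time $t$; nodes are switched off in no other way. For every $n\ge 2$ such a system exists. Let $T_n$ be the first time at which node $1$ receives a signal. Then there exist constants $C_1,C_2>0$ such that for all $n\ge 2$ the expectation $\mathbf{E}(T_n)$ is finite and $$C_1<\frac{\mathbf{E}(T_n)}{\log n}<C_2 .$$ -/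

import Mathlib

open MeasureTheory ProbabilityTheory

/-- Node `i` is on (in state 1) immediately before time `t`: the time `t` lies in one of the
intervals between a recovery of `i` and the next time at which `i` receives a signal.
Here `R i k` is the `(k+1)`-st recovery time of node `i`, and `S i k` is the `k`-th time at which
node `i` receives a signal, with `S i 0` the starting time. -/
def OnJustBefore {n : ℕ} (R S : Fin n → ℕ → ℝ) (i : Fin n) (t : ℝ) : Prop :=
  ∃ k : ℕ, R i k < t ∧ t ≤ S i (k + 1)

/-- Node `i` receives a signal (switches from on to off) at time `t`. -/
def ReceivesAt {n : ℕ} (S : Fin n → ℕ → ℝ) (i : Fin n) (t : ℝ) : Prop :=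
  ∃ k : ℕ, t = S i (k + 1)

/-- A trajectory of the on-off system with permanent input on the chain of nodes `Fin n`, recorded
through the recovery times `R i k` and the reception times `S i k`. The leftmost node is `0`
and the rightmost node is `⊤`. -/
structure IsPermanentOnOffPath {n : ℕ} [NeZero n] (R S : Fin n → ℕ → ℝ) : Prop where
  /-- At time 0 all nodes are switched off. -/
  start : ∀ i, S i 0 = 0
  /-- After each switch to off, a node stays off for a positive time until it recovers. -/
  recovers : ∀ i k, S i k < R i k
  /-- After each recovery a node stays on until it next receives a signal. -/
  receives : ∀ i k, R i k ≤ S i (k + 1)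
  /-- Permanent input: the rightmost node receives a signal immediately after each recovery. -/
  permanent : ∀ k, S ⊤ (k + 1) = R ⊤ k
  /-- A signal received by the rightmost node switches off the whole string of on-nodes attached
  to that node, and this is the only way in which a node is switched off. -/
  signal : ∀ i t, ReceivesAt S i t ↔
    (ReceivesAt S ⊤ t ∧ ∀ j, i ≤ j → j < ⊤ → OnJustBefore R S j t)

/-- The (random) on-off system with permanent input on the chain of nodes `Fin n` with recovery
rates `ρ i`: almost surely the trajectory follows the on-off dynamics, and the lengths of the
successive periods during which the nodes are off are independent, those of node `i` being
exponentially distributed with rate `ρ i`. -/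
structure IsPermanentOnOffSystem {n : ℕ} [NeZero n] (ρ : Fin n → ℝ)
    {Ω : Type*} [MeasurableSpace Ω] (P : Measure Ω) (R S : Fin n → ℕ → Ω → ℝ) : Prop where
  isProbabilityMeasure : IsProbabilityMeasure P
  aemeasurable_recovery : ∀ i k, AEMeasurable (R i k) P
  aemeasurable_reception : ∀ i k, AEMeasurable (S i k) P
  path : ∀ᵐ ω ∂P, IsPermanentOnOffPath (fun i k => R i k ω) (fun i k => S i k ω)
  law_off : ∀ i k, HasLaw (fun ω => R i k ω - S i k ω) (expMeasure (ρ i)) P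
  indep_off : iIndepFun (fun (p : Fin n × ℕ) ω => R p.1 p.2 ω - S p.1 p.2 ω) P

/-- The first time at which the leftmost node receives a signal. -/
def firstReception {n : ℕ} [NeZero n] {Ω : Type*} (S : Fin n → ℕ → Ω → ℝ) : Ω → ℝ :=
  S 0 1

/-! Number the nodes by their distance `j` from the right end. After a reception, node `j + 1` stays
off for an exponential delay and then takes the first later reception of node `j`. So the receptions
at distance `j + 1` are a thinning of those at distance `j`: a new gap is the sum of old gaps up to
the first partial sum beyond an independent delay. By the strong Markov property
(`map_thinGap_thinStep`) i.i.d. gaps stay i.i.d., with laws `gapLaw j` starting from the exponential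
law, and `E(T_n)` is the mean of `gapLaw (n - 1)`.

Let `L_j` be the Laplace transform of `gapLaw j` and `q_j = 1 - L_j`. An exponential delay exceeds a
partial sum `x` with probability `exp (-x)`, which shifts the argument of `L_j` by one; a geometric
series then gives `q_{j+1}(s) = q_j(s) / q_j(s + 1)` (`lintegral_expIntegral_thinGap`). Here `-log
q_0(s) = log ((s + 1) / s)` is the integral of `1 / y` over `[s, s + 1]`, so `-log q_j(s)` is the
integral of the `j`-th iterated difference of `1 / y`, which is `betaKernel j`. Letting `s = 0`, the
mean is multiplied by `1 / q_j(1)` at each node, so `E(T_n)` is the exponential of the sum of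
`betaIntegral i 1` over `i < n - 1`.

That sum is estimated under the integral: `x` times the sum of the kernels at `1 + x` telescopes to
`1 - ∏ l / (l + x)`, which is comparable to `x H / (1 + x H)` for the harmonic number `H` of index
`n - 1`. Integration gives `log (1 + H)` up to an additive error in `[0, 2]`. Hence `E(T_n)` lies
between `1 + H` and `e² (1 + H)`, and `H` is `log n` up to a bounded error. -/

/-! ### Beta integrals and the size of their sum -/

/-- The kernel `j! / (y (y + 1) ⋯ (y + j))`. -/
noncomputable def betaKernel (j : ℕ) (y : ℝ) : ℝ :=
  (j.factorial : ℝ) / ∏ l ∈ Finset.range (j + 1), (y + l)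

/-- Hence `betaKernel j` is the `j`-fold iterated difference of `1 / y`, matching the recursion
`q_{j+1}(s) = q_j(s) / q_j(s + 1)` after taking logarithms. -/
lemma betaKernel_sub {y : ℝ} (hy : 0 < y) (j : ℕ) :
    betaKernel j y - betaKernel j (y + 1) = betaKernel (j + 1) y := by
  have hp : 0 < ∏ l ∈ Finset.range j, (y + 1 + l) :=
    Finset.prod_pos fun l _ => by positivity
  have h1 : ∏ l ∈ Finset.range (j + 1), (y + l) = y * ∏ l ∈ Finset.range j, (y + 1 + l) := by
    rw [Finset.prod_range_succ', mul_comm]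
    congr 1
    · simp
    · refine Finset.prod_congr rfl fun l _ => ?_
      push_cast
      ring
  have h2 : (0 : ℝ) < y + (j + 1) := by positivity
  have h3 : (0 : ℝ) < y + 1 + j := by positivity
  unfold betaKernel
  rw [Finset.prod_range_succ _ (j + 1), h1, Finset.prod_range_succ, Nat.factorial_succ]
  push_cast
  field_simp
  ring

lemma continuousOn_betaKernel (j : ℕ) : ContinuousOn (betaKernel j) (Set.Ioi 0) := by
  refine ContinuousOn.div continuousOn_const (by fun_prop) fun y hy => ?_
  exact (Finset.prod_pos fun l _ => add_pos_of_pos_of_nonneg hy (Nat.cast_nonneg l)).ne'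

lemma intervalIntegrable_betaKernel {s : ℝ} (hs : 0 < s) (j : ℕ) :
    IntervalIntegrable (fun x => betaKernel j (s + x)) volume 0 1 := by
  refine ContinuousOn.intervalIntegrable ?_
  refine (continuousOn_betaKernel j).comp (by fun_prop) fun x hx => ?_
  rw [Set.uIcc_of_le zero_le_one] at hx
  exact add_pos_of_pos_of_nonneg hs hx.1

/-- The integral of `betaKernel j` over an interval of length one. -/
noncomputable def betaIntegral (j : ℕ) (s : ℝ) : ℝ := ∫ x in (0 : ℝ)..1, betaKernel j (s + x)

lemma betaIntegral_succ {s : ℝ} (hs : 0 < s) (j : ℕ) :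
    betaIntegral (j + 1) s = betaIntegral j s - betaIntegral j (s + 1) := by
  rw [betaIntegral, betaIntegral, betaIntegral,
    ← intervalIntegral.integral_sub (intervalIntegrable_betaKernel hs j)
    (intervalIntegrable_betaKernel (by positivity) j)]
  refine intervalIntegral.integral_congr fun x hx => ?_
  rw [Set.uIcc_of_le zero_le_one] at hx
  have : 0 < s + x := add_pos_of_pos_of_nonneg hs hx.1
  rw [← betaKernel_sub this, add_right_comm]

lemma exp_neg_betaIntegral_zero {s : ℝ} (hs : 0 < s) :
    Real.exp (-betaIntegral 0 s) = s / (s + 1) := by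
  have : betaIntegral 0 s = Real.log ((s + 1) / s) := by
    unfold betaIntegral betaKernel
    simp only [Nat.factorial_zero, Nat.cast_one, zero_add, Finset.range_one, Finset.prod_singleton,
      Nat.cast_zero, add_zero]
    rw [intervalIntegral.integral_comp_add_left (fun x => 1 / x), integral_one_div_of_pos]
    · rw [add_zero]
    · rwa [add_zero]
    · positivity
  rw [this, ← Real.log_inv, Real.exp_log (by positivity), inv_div]

/-- The product `∏_{l = 1}^j l / (l + x)`. -/
noncomputable def gammaQuotient (j : ℕ) (x : ℝ) : ℝ :=
  ∏ l ∈ Finset.range j, ((l + 1 : ℝ) / (l + 1 + x))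

/-- The factor `x` turns the kernel into a difference of consecutive products, so that sums over `j`
telescope. -/
lemma mul_betaKernel_one_add {x : ℝ} (hx : 0 ≤ x) (j : ℕ) :
    x * betaKernel j (1 + x) = gammaQuotient j x - gammaQuotient (j + 1) x := by
  have h1 : ∀ j : ℕ, betaKernel j (1 + x) = gammaQuotient j x / (j + 1 + x) := by
    intro j
    unfold betaKernel gammaQuotient
    rw [Finset.prod_div_distrib, Finset.prod_range_succ, div_div]
    congr 1
    · rw [← Finset.prod_range_add_one_eq_factorial]; push_cast; rfl
    · congr 1
      · exact Finset.prod_congr rfl fun l _ => by ring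
      · ring
  have h2 : (0 : ℝ) < j + 1 + x := by positivity
  rw [h1]
  unfold gammaQuotient
  rw [Finset.prod_range_succ]
  field_simp
  ring

lemma mul_sum_betaKernel {x : ℝ} (hx : 0 ≤ x) (j : ℕ) :
    x * ∑ i ∈ Finset.range j, betaKernel i (1 + x) = 1 - gammaQuotient j x := by
  rw [Finset.mul_sum, Finset.sum_congr rfl fun i _ => mul_betaKernel_one_add hx i,
    Finset.sum_range_sub']
  simp [gammaQuotient]

/-- The harmonic numbers as reals. -/
noncomputable def realHarmonic (j : ℕ) : ℝ := ∑ l ∈ Finset.range j, (1 : ℝ) / (l + 1)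

lemma realHarmonic_eq (j : ℕ) : realHarmonic j = (harmonic j : ℝ) := by
  simp [realHarmonic, harmonic]

lemma realHarmonic_nonneg (j : ℕ) : 0 ≤ realHarmonic j :=
  Finset.sum_nonneg fun l _ => by positivity

/-- The factors are `1 / (1 + u)` with `u = x / (l + 1)`, and the `u` add up to `x H`; the bounds
are the Bernoulli-type inequalities `∏ (1 + u) ≥ 1 + ∑ u` and `∏ 1 / (1 + u) ≥ 1 - ∑ u`. -/
lemma gammaQuotient_bounds {x : ℝ} (hx : 0 ≤ x) (j : ℕ) :
    0 ≤ gammaQuotient j x ∧ 1 - x * realHarmonic j ≤ gammaQuotient j x ∧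
      gammaQuotient j x * (1 + x * realHarmonic j) ≤ 1 := by
  induction j with
  | zero => simp [gammaQuotient, realHarmonic]
  | succ j ih =>
    obtain ⟨h0, h1, h2⟩ := ih
    have hH := realHarmonic_nonneg j
    have hg : gammaQuotient (j + 1) x = gammaQuotient j x * ((j + 1 : ℝ) / (j + 1 + x)) :=
      Finset.prod_range_succ _ _
    have hh : realHarmonic (j + 1) = realHarmonic j + 1 / (j + 1 : ℝ) :=
      Finset.sum_range_succ _ _
    set u : ℝ := x / (j + 1) with hu
    have hu0 : 0 ≤ u := by positivity
    have hq : ((j + 1 : ℝ) / (j + 1 + x)) = 1 / (1 + u) := by rw [hu]; field_simp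
    have hxu : x * (realHarmonic j + 1 / (j + 1 : ℝ)) = x * realHarmonic j + u := by
      rw [hu]; ring
    rw [hg, hh, hq, hxu]
    have hle : gammaQuotient j x ≤ 1 := by nlinarith [mul_nonneg hx hH, mul_nonneg h0 (mul_nonneg hx hH)]
    refine ⟨by positivity, ?_, ?_⟩
    · rw [mul_one_div, le_div_iff₀ (by positivity)]
      nlinarith [mul_nonneg hx hH, mul_nonneg (mul_nonneg hx hH) hu0, mul_nonneg hu0 hu0]
    · rw [mul_one_div, div_mul_eq_mul_div, div_le_one (by positivity)]
      nlinarith [mul_nonneg hx hH, mul_nonneg h0 hu0]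

/-- The sum is at most `min H (1 / x)`. The stated upper bound dominates this minimum and has an
elementary primitive whose second part contributes at most `2`. -/
lemma sum_betaKernel_bounds {x : ℝ} (hx : 0 < x) (j : ℕ) :
    realHarmonic j / (1 + x * realHarmonic j) ≤ ∑ i ∈ Finset.range j, betaKernel i (1 + x) ∧
    ∑ i ∈ Finset.range j, betaKernel i (1 + x) ≤
      realHarmonic j / (1 + x * realHarmonic j) +
        2 * (realHarmonic j / (1 + x * realHarmonic j) ^ 2) := by
  obtain ⟨h0, h1, h2⟩ := gammaQuotient_bounds hx.le j
  have h := mul_sum_betaKernel hx.le j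
  set s := ∑ i ∈ Finset.range j, betaKernel i (1 + x)
  have hH := realHarmonic_nonneg j
  set H := realHarmonic j
  have hu := mul_nonneg hx.le hH
  constructor
  · rw [div_le_iff₀ (by positivity)]
    have : x * H ≤ x * (s * (1 + x * H)) := by nlinarith
    exact le_of_mul_le_mul_left this hx
  · have e : H / (1 + x * H) + 2 * (H / (1 + x * H) ^ 2) =
        (H * (1 + x * H) + 2 * H) / (1 + x * H) ^ 2 := by field_simp
    rw [e, le_div_iff₀ (by positivity)]
    refine le_of_mul_le_mul_left ?_ hx
    -- With `u = x H`, the claim is `u (1 + u)² ≤ u² + 3 u` if `u ≤ 1`, and `(1 + u)² ≤ u² + 3 u` if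
    -- `u ≥ 1`.
    rcases le_total (x * H) 1 with h3 | h3
    · have : x * s ≤ x * H := by linarith
      nlinarith [mul_le_mul_of_nonneg_right this (sq_nonneg (1 + x * H)),
        mul_nonneg hu (sub_nonneg.2 h3), mul_nonneg (mul_nonneg hu hu) (sub_nonneg.2 h3)]
    · have : x * s ≤ 1 := by linarith
      nlinarith [mul_le_mul_of_nonneg_right this (sq_nonneg (1 + x * H))]

lemma sum_betaIntegral_bounds (j : ℕ) :
    Real.log (1 + realHarmonic j) ≤ ∑ i ∈ Finset.range j, betaIntegral i 1 ∧
    ∑ i ∈ Finset.range j, betaIntegral i 1 ≤ Real.log (1 + realHarmonic j) + 2 := by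
  have hH := realHarmonic_nonneg j
  have hsum : ∑ i ∈ Finset.range j, betaIntegral i 1 =
      ∫ x in (0 : ℝ)..1, ∑ i ∈ Finset.range j, betaKernel i (1 + x) := by
    rw [intervalIntegral.integral_finsetSum]
    · rfl
    · exact fun i _ => intervalIntegrable_betaKernel one_pos i
  have hint : IntervalIntegrable (fun x => ∑ i ∈ Finset.range j, betaKernel i (1 + x))
      volume 0 1 := by
    simpa only [Finset.sum_fn] using IntervalIntegrable.sum (Finset.range j) fun i _ =>
      intervalIntegrable_betaKernel one_pos i
  have hpos : ∀ x ∈ Set.uIcc (0 : ℝ) 1, 0 < 1 + x * realHarmonic j := by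
    intro x hx
    rw [Set.uIcc_of_le zero_le_one] at hx
    have := mul_nonneg hx.1 hH
    positivity
  have c1 : ContinuousOn (fun x => realHarmonic j / (1 + x * realHarmonic j))
      (Set.uIcc (0 : ℝ) 1) :=
    ContinuousOn.div continuousOn_const (by fun_prop) fun x hx => (hpos x hx).ne'
  have c2 : ContinuousOn (fun x => realHarmonic j / (1 + x * realHarmonic j) +
      2 * (realHarmonic j / (1 + x * realHarmonic j) ^ 2)) (Set.uIcc (0 : ℝ) 1) :=
    c1.add (continuousOn_const.mul (ContinuousOn.div continuousOn_const (by fun_prop)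
      fun x hx => (pow_pos (hpos x hx) 2).ne'))
  have hd : ∀ x : ℝ, HasDerivAt (fun x => 1 + x * realHarmonic j) (realHarmonic j) x := by
    intro x
    simpa using ((hasDerivAt_id x).mul_const (realHarmonic j)).const_add 1
  have i1 : ∫ x in (0 : ℝ)..1, realHarmonic j / (1 + x * realHarmonic j) =
      Real.log (1 + realHarmonic j) := by
    rw [intervalIntegral.integral_eq_sub_of_hasDerivAt
      (f := fun x => Real.log (1 + x * realHarmonic j)) _ c1.intervalIntegrable]
    · simp
    · exact fun x hx => (hd x).log (hpos x hx).ne'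
  have i2 : ∫ x in (0 : ℝ)..1, (realHarmonic j / (1 + x * realHarmonic j) +
      2 * (realHarmonic j / (1 + x * realHarmonic j) ^ 2)) =
      Real.log (1 + realHarmonic j) + 2 * (1 - (1 + realHarmonic j)⁻¹) := by
    rw [intervalIntegral.integral_eq_sub_of_hasDerivAt
      (f := fun x => Real.log (1 + x * realHarmonic j) - 2 * (1 + x * realHarmonic j)⁻¹) _
      c2.intervalIntegrable]
    · simp; ring
    · intro x hx
      refine (((hd x).log (hpos x hx).ne').sub
        (((hd x).inv (hpos x hx).ne').const_mul 2)).congr_deriv ?_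
      ring
  rw [hsum]
  constructor
  · rw [← i1]
    refine intervalIntegral.integral_mono_on_of_le_Ioo zero_le_one c1.intervalIntegrable hint ?_
    exact fun x hx => (sum_betaKernel_bounds hx.1 j).1
  · refine (intervalIntegral.integral_mono_on_of_le_Ioo zero_le_one hint
      c2.intervalIntegrable fun x hx => (sum_betaKernel_bounds hx.1 j).2).trans ?_
    rw [i2]
    have : 0 ≤ (1 + realHarmonic j)⁻¹ := by positivity
    linarith

lemma exp_sum_betaIntegral_bounds {n : ℕ} (hn : 2 ≤ n) :
    1 < Real.exp (∑ i ∈ Finset.range (n - 1), betaIntegral i 1) / Real.log n ∧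
    Real.exp (∑ i ∈ Finset.range (n - 1), betaIntegral i 1) / Real.log n <
      Real.exp 2 * (1 + 2 / Real.log 2) + 1 := by
  have hn' : (2 : ℝ) ≤ n := by exact_mod_cast hn
  have hl2 : 0 < Real.log 2 := Real.log_pos one_lt_two
  have hl : Real.log 2 ≤ Real.log n := Real.log_le_log two_pos hn'
  have hln : 0 < Real.log n := hl2.trans_le hl
  obtain ⟨h1, h2⟩ := sum_betaIntegral_bounds (n - 1)
  have hH := realHarmonic_nonneg (n - 1)
  have hlow : Real.log n ≤ realHarmonic (n - 1) := by
    have := log_add_one_le_harmonic (n - 1)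
    rw [realHarmonic_eq]
    have e : ((n - 1 : ℕ) + 1) = n := by omega
    simpa [e, ← Nat.cast_succ] using this
  have hup : realHarmonic (n - 1) ≤ 1 + Real.log n := by
    have h := harmonic_le_one_add_log (n - 1)
    rw [← realHarmonic_eq] at h
    refine h.trans ?_
    gcongr
    · have : 1 ≤ n - 1 := by omega
      exact_mod_cast this
    · omega
  constructor
  · rw [one_lt_div hln]
    have := Real.exp_le_exp.2 h1
    rw [Real.exp_log (by positivity)] at this
    linarith
  · rw [div_lt_iff₀ hln]
    have := Real.exp_le_exp.2 h2
    rw [Real.exp_add, Real.exp_log (by positivity)] at this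
    -- Since `n ≥ 2`, the additive constant in `1 + H ≤ 2 + log n` is absorbed into a multiple of
    -- `log n`. The final `+ 1` in the upper constant only makes the inequality strict.
    have h3 : 2 ≤ 2 / Real.log 2 * Real.log n := by
      rw [div_mul_eq_mul_div, le_div_iff₀ hl2]; nlinarith
    have h4 : 1 + realHarmonic (n - 1) ≤ (1 + 2 / Real.log 2) * Real.log n := by linarith
    have h5 := mul_le_mul_of_nonneg_left h4 (Real.exp_pos 2).le
    nlinarith

/-! ### Thinning a sequence of renewals, pathwise -/

/-- The partial sum of `d` of length `m + 1` is the first one which exceeds `t`. -/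
def IsFirstPassage (d : ℕ → ℝ) (t : ℝ) (m : ℕ) : Prop :=
  t < ∑ i ∈ Finset.range (m + 1), d i ∧ ∀ i < m, ∑ l ∈ Finset.range (i + 1), d l ≤ t

/-- The index of the first partial sum of `d` which exceeds `t`. -/
noncomputable def passageIndex (d : ℕ → ℝ) (t : ℝ) : ℕ :=
  sInf {m | t < ∑ i ∈ Finset.range (m + 1), d i}

lemma IsFirstPassage.passageIndex_eq {d : ℕ → ℝ} {t : ℝ} {m : ℕ} (h : IsFirstPassage d t m) :
    passageIndex d t = m := by
  refine le_antisymm (Nat.sInf_le h.1) ?_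
  by_contra! hlt
  exact absurd (Nat.sInf_mem (⟨m, h.1⟩ : {m | t < ∑ i ∈ Finset.range (m + 1), d i}.Nonempty))
    (not_lt.2 (h.2 _ hlt))

lemma exists_isFirstPassage_iff {d : ℕ → ℝ} {t : ℝ} :
    (∃ m, IsFirstPassage d t m) ↔ ∃ m, t < ∑ i ∈ Finset.range (m + 1), d i := by
  classical
  refine ⟨fun ⟨m, h⟩ => ⟨m, h.1⟩, fun h => ⟨Nat.find h, Nat.find_spec h, fun i hi => ?_⟩⟩
  exact not_lt.1 (Nat.find_min h hi)

/-- The time of the first renewal after an independent delay: the pair consists of the gaps between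
renewals and the delays. -/
noncomputable def thinGap (z : (ℕ → ℝ) × (ℕ → ℝ)) : ℝ :=
  ∑ i ∈ Finset.range (passageIndex z.1 (z.2 0) + 1), z.1 i

/-- The gaps and the delays which remain after the first selected renewal. -/
noncomputable def thinStep (z : (ℕ → ℝ) × (ℕ → ℝ)) : (ℕ → ℝ) × (ℕ → ℝ) :=
  (fun k => z.1 (k + (passageIndex z.1 (z.2 0) + 1)), fun k => z.2 (k + 1))

/-- The gaps between the selected renewals. -/
noncomputable def thin (z : (ℕ → ℝ) × (ℕ → ℝ)) (k : ℕ) : ℝ := thinGap (thinStep^[k] z)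

/-- All delays end before some renewal. -/
def Thinnable (z : (ℕ → ℝ) × (ℕ → ℝ)) : Prop :=
  ∀ k, ∃ m, IsFirstPassage (thinStep^[k] z).1 ((thinStep^[k] z).2 0) m

/-- The index of the `k`-th selected renewal. -/
noncomputable def thinIndex (z : (ℕ → ℝ) × (ℕ → ℝ)) : ℕ → ℕ
  | 0 => 0
  | k + 1 => thinIndex z k + passageIndex (fun i => z.1 (i + thinIndex z k)) (z.2 k) + 1

lemma iterate_thinStep (z : (ℕ → ℝ) × (ℕ → ℝ)) (k : ℕ) :
    thinStep^[k] z = (fun i => z.1 (i + thinIndex z k), fun i => z.2 (i + k)) := by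
  induction k with
  | zero => rfl
  | succ k ih =>
    rw [Function.iterate_succ_apply', ih]
    simp only [thinStep, thinIndex, zero_add, Prod.mk.injEq]
    constructor
    · exact funext fun i => congrArg z.1 (by omega)
    · exact funext fun i => congrArg z.2 (by omega)

lemma thin_eq (z : (ℕ → ℝ) × (ℕ → ℝ)) (k : ℕ) :
    thin z k = ∑ i ∈ Finset.range (thinIndex z (k + 1)), z.1 i -
      ∑ i ∈ Finset.range (thinIndex z k), z.1 i := by
  rw [thin, iterate_thinStep, thinGap, thinIndex, add_assoc,
    Finset.sum_range_add _ (thinIndex z k), add_sub_cancel_left]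
  simp only [zero_add]
  exact Finset.sum_congr rfl fun i _ => by rw [add_comm]

lemma sum_thin (z : (ℕ → ℝ) × (ℕ → ℝ)) (k : ℕ) :
    ∑ i ∈ Finset.range k, thin z i = ∑ i ∈ Finset.range (thinIndex z k), z.1 i := by
  simp_rw [thin_eq]
  rw [Finset.sum_range_sub (fun k => ∑ i ∈ Finset.range (thinIndex z k), z.1 i)]
  simp [thinIndex]

/-- `b (k + 1)` is the first of the times `a 1, a 2, …` after `b k + e k`. -/
def IsSelection (a b e : ℕ → ℝ) : Prop :=
  ∀ k, IsLeast {t | ∃ m, t = a (m + 1) ∧ b k + e k < t} (b (k + 1))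

/-- Existence half: thinning does produce a selection. This is what builds a chain from given
off-periods. -/
lemma Thinnable.isSelection {z : (ℕ → ℝ) × (ℕ → ℝ)} (hz : Thinnable z) (hd : ∀ k, 0 < z.1 k)
    (he : ∀ k, 0 < z.2 k) :
    IsSelection (fun m => ∑ i ∈ Finset.range m, z.1 i) (fun k => ∑ i ∈ Finset.range k, thin z i)
      z.2 := by
  have hmono : StrictMono fun m => ∑ i ∈ Finset.range m, z.1 i :=
    strictMono_nat_of_lt_succ fun m => by rw [Finset.sum_range_succ]; linarith [hd m]
  intro k
  obtain ⟨m, hm⟩ := hz k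
  rw [iterate_thinStep] at hm
  have hidx := hm.passageIndex_eq
  simp only [zero_add] at hm hidx
  simp only [sum_thin]
  have hsum : ∀ j, ∑ i ∈ Finset.range (thinIndex z k + j), z.1 i =
      ∑ i ∈ Finset.range (thinIndex z k), z.1 i +
        ∑ i ∈ Finset.range j, z.1 (i + thinIndex z k) := by
    intro j
    rw [Finset.sum_range_add]; simp [add_comm]
  constructor
  · refine ⟨_, rfl, ?_⟩
    rw [thinIndex, hidx, add_assoc, hsum]
    linarith [hm.1]
  · rintro t ⟨l, rfl, hl⟩
    have h1 : thinIndex z k < l + 1 := by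
      rw [← hmono.lt_iff_lt]; linarith [he k]
    obtain ⟨j, rfl⟩ : ∃ j, l = thinIndex z k + j := ⟨l - thinIndex z k, by omega⟩
    refine hmono.monotone ?_
    rw [thinIndex, hidx]
    by_contra! hlt
    have h2 := hm.2 j (by omega)
    rw [add_assoc, hsum] at hl
    linarith

/-- Uniqueness half: by induction the selected times are the renewals with indices `thinIndex z k`.
No finiteness of passage is assumed, since the selection itself exhibits it. -/
lemma IsSelection.gaps_eq {a b e : ℕ → ℝ} (h : IsSelection a b e) (ha : StrictMono a)
    (hab : b 0 = a 0) (ha0 : a 0 = 0) (he : ∀ k, 0 < e k) (k : ℕ) :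
    b (k + 1) - b k = thin (fun m => a (m + 1) - a m, e) k := by
  set z : (ℕ → ℝ) × (ℕ → ℝ) := (fun m => a (m + 1) - a m, e) with hz
  have hsum : ∀ m, ∑ i ∈ Finset.range m, z.1 i = a m := fun m => by
    rw [Finset.sum_range_sub, ha0, sub_zero]
  have hb : ∀ k, b k = a (thinIndex z k) := by
    intro k
    induction k with
    | zero => exact hab
    | succ k ih =>
      obtain ⟨⟨m, hm, hlt⟩, hmin⟩ := h k
      have h1 : thinIndex z k < m + 1 := by
        rw [← ha.lt_iff_lt, ← ih, ← hm]; linarith [he k]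
      obtain ⟨j, rfl⟩ : ∃ j, m = thinIndex z k + j := ⟨m - thinIndex z k, by omega⟩
      have hs : ∀ j, ∑ i ∈ Finset.range j, z.1 (i + thinIndex z k) =
          a (thinIndex z k + j) - b k := by
        intro j
        rw [ih, ← hsum, ← hsum (thinIndex z k), Finset.sum_range_add]; simp [add_comm]
      have hp : IsFirstPassage (fun i => z.1 (i + thinIndex z k)) (z.2 k) j := by
        constructor
        · rw [hs, ← add_assoc, ← hm]
          have : z.2 k = e k := rfl
          linarith
        · intro i hi
          rw [hs]
          by_contra! hc
          have h3 := hmin ⟨thinIndex z k + i, rfl, by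
            have : z.2 k = e k := rfl
            rw [add_assoc]; linarith⟩
          rw [hm] at h3
          have := ha.le_iff_le.1 h3
          omega
      rw [hm, thinIndex, hp.passageIndex_eq]
  rw [thin_eq, hsum, hsum, ← hb, ← hb]

/-! ### Measurability of the thinning -/

lemma measurableSet_isFirstPassage (m : ℕ) :
    MeasurableSet {p : (ℕ → ℝ) × ℝ | IsFirstPassage p.1 p.2 m} := by
  have hs : ∀ i : ℕ, Measurable fun p : (ℕ → ℝ) × ℝ => ∑ l ∈ Finset.range (i + 1), p.1 l :=
    fun i => Finset.measurable_sum _ fun l _ => by fun_prop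
  refine MeasurableSet.inter (measurableSet_lt measurable_snd (hs m)) ?_
  have : {p : (ℕ → ℝ) × ℝ | ∀ i < m, ∑ l ∈ Finset.range (i + 1), p.1 l ≤ p.2} =
      ⋂ i, ⋂ (_ : i < m), {p | ∑ l ∈ Finset.range (i + 1), p.1 l ≤ p.2} := by
    ext; simp
  change MeasurableSet {p : (ℕ → ℝ) × ℝ | ∀ i < m, ∑ l ∈ Finset.range (i + 1), p.1 l ≤ p.2}
  rw [this]
  exact .iInter fun i => .iInter fun _ => measurableSet_le (hs i) measurable_snd

lemma measurable_passageIndex :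
    Measurable fun p : (ℕ → ℝ) × ℝ => passageIndex p.1 p.2 := by
  refine measurable_to_countable' fun m => ?_
  -- Without a passage the index is `sInf ∅ = 0`, so the fibre over `0` also contains all such
  -- points.
  have : (fun p : (ℕ → ℝ) × ℝ => passageIndex p.1 p.2) ⁻¹' {m} =
      {p | IsFirstPassage p.1 p.2 m} ∪
        ((⋃ m, {p : (ℕ → ℝ) × ℝ | IsFirstPassage p.1 p.2 m})ᶜ ∩ {p | m = 0}) := by
    ext p
    simp only [Set.mem_preimage, Set.mem_singleton_iff, Set.mem_union, Set.mem_ofPred_eq,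
      Set.mem_inter_iff, Set.mem_compl_iff, Set.mem_iUnion]
    by_cases h : ∃ m, IsFirstPassage p.1 p.2 m
    · obtain ⟨l, hl⟩ := h
      rw [hl.passageIndex_eq]
      constructor
      · rintro rfl; exact .inl hl
      · rintro (h | h)
        · rw [← hl.passageIndex_eq, h.passageIndex_eq]
        · exact absurd ⟨l, hl⟩ h.1
    · have h0 : passageIndex p.1 p.2 = 0 := by
        rw [exists_isFirstPassage_iff] at h
        have : {m | p.2 < ∑ i ∈ Finset.range (m + 1), p.1 i} = ∅ :=
          Set.eq_empty_iff_forall_notMem.2 fun m hm => h ⟨m, hm⟩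
        rw [passageIndex, this, Nat.sInf_empty]
      rw [h0]
      constructor
      · exact fun h1 => .inr ⟨h, h1.symm⟩
      · rintro (h1 | h1)
        · exact absurd ⟨m, h1⟩ h
        · exact h1.2.symm
  rw [this]
  exact (measurableSet_isFirstPassage m).union
    ((MeasurableSet.iUnion measurableSet_isFirstPassage).compl.inter (.const _))

lemma measurable_thinGap : Measurable thinGap := by
  have h1 : Measurable fun q : ℕ × (ℕ → ℝ) => ∑ i ∈ Finset.range (q.1 + 1), q.2 i :=
    measurable_from_prod_countable_right fun n =>
      Finset.measurable_sum (Finset.range (n + 1)) fun i _ => measurable_pi_apply i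
  have h2 : Measurable fun z : (ℕ → ℝ) × (ℕ → ℝ) => passageIndex z.1 (z.2 0) :=
    measurable_passageIndex.comp (f := fun z : (ℕ → ℝ) × (ℕ → ℝ) => (z.1, z.2 0)) (by fun_prop)
  exact h1.comp (h2.prodMk measurable_fst)

lemma measurable_thinStep : Measurable thinStep := by
  have h1 : ∀ k, Measurable fun q : ℕ × (ℕ → ℝ) => q.2 (k + (q.1 + 1)) := fun k =>
    measurable_from_prod_countable_right fun n => measurable_pi_apply (k + (n + 1))
  have h2 : Measurable fun z : (ℕ → ℝ) × (ℕ → ℝ) => passageIndex z.1 (z.2 0) :=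
    measurable_passageIndex.comp (f := fun z : (ℕ → ℝ) × (ℕ → ℝ) => (z.1, z.2 0)) (by fun_prop)
  exact (measurable_pi_lambda _ fun k => (h1 k).comp (h2.prodMk measurable_fst)).prodMk
    (by fun_prop)

lemma measurable_thin : Measurable thin :=
  measurable_pi_lambda _ fun k => measurable_thinGap.comp (measurable_thinStep.iterate k)

/-! ### On-off paths as iterated thinnings -/

lemma Fin.val_top_eq {n : ℕ} [NeZero n] : ((⊤ : Fin n) : ℕ) = n - 1 := by
  cases n with
  | zero => exact absurd rfl (NeZero.ne 0)
  | succ n => rfl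

lemma thin_pos {z : (ℕ → ℝ) × (ℕ → ℝ)} (hz : ∀ k, 0 < z.1 k) (k : ℕ) : 0 < thin z k := by
  rw [thin, iterate_thinStep, thinGap]
  exact Finset.sum_pos (fun i _ => hz _) (by simp)

lemma strictMono_of_interlacing {b r : ℕ → ℝ} (h1 : ∀ k, b k < r k) (h2 : ∀ k, r k ≤ b (k + 1)) :
    StrictMono b :=
  strictMono_nat_of_lt_succ fun k => (h1 k).trans_le (h2 k)

lemma IsSelection.le_succ {a b r : ℕ → ℝ} (h : IsSelection a b fun k => r k - b k) (k : ℕ) :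
    r k ≤ b (k + 1) := by
  obtain ⟨m, hm, hlt⟩ := (h k).1
  linarith

lemma IsSelection.exists_iff {a b r : ℕ → ℝ} (h : IsSelection a b fun k => r k - b k) (t : ℝ) :
    (∃ k, t = b (k + 1)) ↔ (∃ m, t = a (m + 1)) ∧ ∃ k, r k < t ∧ t ≤ b (k + 1) := by
  constructor
  · rintro ⟨k, rfl⟩
    obtain ⟨m, hm, hlt⟩ := (h k).1
    exact ⟨⟨m, hm⟩, k, by linarith, le_rfl⟩
  · rintro ⟨⟨m, hm⟩, k, hk, hle⟩
    exact ⟨k, le_antisymm hle ((h k).2 ⟨m, hm, by linarith⟩)⟩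

/-- A time `a (m + 1)` strictly between `r k` and `b (k + 1)` would be a reception, hence some `b (l
+ 1)` strictly between `b k` and `b (k + 1)`, contradicting monotonicity. -/
lemma isSelection_of_exists_iff {a b r : ℕ → ℝ} (h1 : ∀ k, b k < r k)
    (h2 : ∀ k, r k ≤ b (k + 1))
    (h : ∀ t, (∃ k, t = b (k + 1)) ↔ (∃ m, t = a (m + 1)) ∧ ∃ k, r k < t ∧ t ≤ b (k + 1)) :
    IsSelection a b fun k => r k - b k := by
  have hb := strictMono_of_interlacing h1 h2
  intro k
  constructor
  · obtain ⟨⟨m, hm⟩, l, hl, hle⟩ := (h (b (k + 1))).1 ⟨k, rfl⟩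
    have h3 := hb.lt_iff_lt.1 ((h1 l).trans hl)
    have h4 := hb.le_iff_le.1 hle
    obtain rfl : k = l := by omega
    exact ⟨m, hm, by linarith⟩
  · rintro t ⟨m, rfl, hlt⟩
    by_contra! hc
    obtain ⟨l, hl⟩ := (h (a (m + 1))).2 ⟨⟨m, rfl⟩, k, by linarith, hc.le⟩
    rw [hl] at hc hlt
    have h3 := hb.lt_iff_lt.1 hc
    have h4 : b k < b (l + 1) := by linarith [h1 k]
    have := hb.lt_iff_lt.1 h4
    omega

/-- Splits off the leftmost node of the string, making the global signal rule a rule between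
neighbours: a node receives exactly when its right neighbour does and it is itself on. -/
lemma forall_le_lt_top_iff {n : ℕ} [NeZero n] {i j : Fin n} (hij : (j : ℕ) = i + 1)
    (p : Fin n → Prop) :
    (∀ l, i ≤ l → l < ⊤ → p l) ↔ (∀ l, j ≤ l → l < ⊤ → p l) ∧ p i := by
  have ht := Fin.val_top_eq (n := n)
  constructor
  · refine fun h => ⟨fun l hl => h l ?_, h i le_rfl ?_⟩
    · rw [Fin.le_def] at *; omega
    · rw [Fin.lt_def]; omega
  · rintro ⟨h1, h2⟩ l hl hlt
    rcases eq_or_ne l i with rfl | hne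
    · exact h2
    · refine h1 l ?_ hlt
      rw [Fin.le_def] at *
      have := Fin.val_ne_of_ne hne
      omega

lemma IsPermanentOnOffPath.isSelection {n : ℕ} [NeZero n] {R S : Fin n → ℕ → ℝ}
    (h : IsPermanentOnOffPath R S) {i j : Fin n} (hij : (j : ℕ) = i + 1) :
    IsSelection (S j) (S i) fun k => R i k - S i k := by
  refine isSelection_of_exists_iff (h.recovers i) (h.receives i) fun t => ?_
  have h1 := h.signal i t
  rw [forall_le_lt_top_iff hij, ← and_assoc, ← h.signal j t] at h1
  exact h1

lemma isPermanentOnOffPath_of_isSelection {n : ℕ} [NeZero n] {R S : Fin n → ℕ → ℝ}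
    (h0 : ∀ i, S i 0 = 0) (h1 : ∀ i k, S i k < R i k) (h2 : ∀ k, S ⊤ (k + 1) = R ⊤ k)
    (h : ∀ i j : Fin n, (j : ℕ) = i + 1 → IsSelection (S j) (S i) fun k => R i k - S i k) :
    IsPermanentOnOffPath R S where
  start := h0
  recovers := h1
  receives i k := by
    have ht := Fin.val_top_eq (n := n)
    by_cases hi : i = ⊤
    · subst hi; exact (h2 k).ge
    · have : (i : ℕ) ≠ n - 1 := fun h => hi (Fin.ext (h.trans ht.symm))
      exact (h i ⟨i + 1, by omega⟩ rfl).le_succ k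
  permanent := h2
  signal := by
    have ht := Fin.val_top_eq (n := n)
    suffices H : ∀ l (i : Fin n), (i : ℕ) + l + 1 = n → ∀ t, ReceivesAt S i t ↔
        (ReceivesAt S ⊤ t ∧ ∀ j, i ≤ j → j < ⊤ → OnJustBefore R S j t) from
      fun i => H (n - 1 - i) i (by omega)
    intro l
    induction l with
    | zero =>
      intro i hi t
      obtain rfl : i = ⊤ := Fin.ext (by omega)
      exact ⟨fun h => ⟨h, fun j h1 h2 => absurd h2 (not_lt.2 h1)⟩, fun h => h.1⟩
    | succ l ih =>
      intro i hi t
      have hij : ((⟨i + 1, by omega⟩ : Fin n) : ℕ) = i + 1 := rfl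
      rw [forall_le_lt_top_iff hij, ← and_assoc, ← ih _ (by simp only; omega) t]
      exact (h i _ hij).exists_iff t

/-- The gaps between the receptions at distance `j` from the rightmost node, in terms of the
off-periods `y (l, k)` of the nodes at distance `l`. -/
noncomputable def gaps : ℕ → (ℕ × ℕ → ℝ) → ℕ → ℝ
  | 0, y => fun k => y (0, k)
  | j + 1, y => thin (gaps j y, fun k => y (j + 1, k))

lemma IsPermanentOnOffPath.gaps_eq {n : ℕ} [NeZero n] {R S : Fin n → ℕ → ℝ}
    (h : IsPermanentOnOffPath R S) {y : ℕ × ℕ → ℝ}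
    (hy : ∀ (i : Fin n) k, y (n - 1 - i, k) = R i k - S i k) (l : ℕ) :
    ∀ i : Fin n, (i : ℕ) + l + 1 = n → (fun k => S i (k + 1) - S i k) = gaps l y := by
  have ht := Fin.val_top_eq (n := n)
  induction l with
  | zero =>
    intro i hi
    obtain rfl : i = ⊤ := Fin.ext (by omega)
    funext k
    rw [gaps, h.permanent, ← hy, ht, Nat.sub_self]
  | succ l ih =>
    intro i hi
    have hij : ((⟨i + 1, by omega⟩ : Fin n) : ℕ) = i + 1 := rfl
    funext k
    rw [(h.isSelection hij).gaps_eq (strictMono_of_interlacing (h.recovers _) (h.receives _))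
      (by rw [h.start, h.start]) (h.start _) (fun k => sub_pos.2 (h.recovers i k)),
      ih _ (by simp only; omega), gaps]
    congr 2
    funext k
    rw [← hy, show n - 1 - (i : ℕ) = l + 1 by omega]

lemma IsPermanentOnOffPath.reception_one {n : ℕ} [NeZero n] {R S : Fin n → ℕ → ℝ}
    (h : IsPermanentOnOffPath R S) {y : ℕ × ℕ → ℝ}
    (hy : ∀ (i : Fin n) k, y (n - 1 - i, k) = R i k - S i k) :
    S 0 1 = gaps (n - 1) y 0 := by
  have hn := NeZero.pos n
  have := congrFun (h.gaps_eq hy (n - 1) 0 (by rw [Fin.val_zero]; omega)) 0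
  simpa [h.start] using this

lemma gaps_pos {y : ℕ × ℕ → ℝ} (hy : ∀ p, 0 < y p) (j k : ℕ) : 0 < gaps j y k := by
  induction j generalizing k with
  | zero => exact hy _
  | succ j ih => exact thin_pos ih k

lemma isPermanentOnOffPath_gaps {n : ℕ} [NeZero n] {y : ℕ × ℕ → ℝ} (hy : ∀ p, 0 < y p)
    (hthin : ∀ j, Thinnable (gaps j y, fun k => y (j + 1, k))) :
    IsPermanentOnOffPath (n := n)
      (fun i k => ∑ m ∈ Finset.range k, gaps (n - 1 - i) y m + y (n - 1 - i, k))
      (fun i k => ∑ m ∈ Finset.range k, gaps (n - 1 - i) y m) := by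
  refine isPermanentOnOffPath_of_isSelection (by simp) (fun i k => by simpa using hy _) ?_ ?_
  · intro k
    rw [Fin.val_top_eq, Nat.sub_self, Finset.sum_range_succ, gaps]
  · intro i j hij
    have e : n - 1 - (i : ℕ) = (n - 1 - j) + 1 := by omega
    simp only [add_sub_cancel_left, e]
    exact (hthin (n - 1 - j)).isSelection (gaps_pos hy _) fun k => hy _

lemma measurable_gaps (j : ℕ) : Measurable (gaps j) := by
  induction j with
  | zero => exact measurable_pi_lambda _ fun k => measurable_pi_apply _
  | succ j ih =>
    exact measurable_thin.comp (ih.prodMk (measurable_pi_lambda _ fun k => measurable_pi_apply _))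

/-- A chain of `n` nodes thus only uses the rows `0, …, n - 1`, and one infinite array serves all
`n`. -/
lemma gaps_congr {y y' : ℕ × ℕ → ℝ} {j : ℕ} (h : ∀ l ≤ j, ∀ k, y (l, k) = y' (l, k)) :
    gaps j y = gaps j y' := by
  induction j with
  | zero => exact funext fun k => h 0 le_rfl k
  | succ j ih =>
    rw [gaps, gaps, ih fun l hl => h l (by omega)]
    simp only [h (j + 1) le_rfl]

/-! ### Independence and the strong Markov property -/

/-- The law of independent gaps with law `ν` together with independent delays with law `η`. -/
noncomputable def renewalMeasure (ν η : Measure ℝ) : Measure ((ℕ → ℝ) × (ℕ → ℝ)) :=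
  (Measure.infinitePi fun _ : ℕ => ν).prod (Measure.infinitePi fun _ : ℕ => η)

instance (ν η : Measure ℝ) [IsProbabilityMeasure ν] [IsProbabilityMeasure η] :
    IsProbabilityMeasure (renewalMeasure ν η) := by
  unfold renewalMeasure; infer_instance

lemma measurable_sumElim {ι κ : Type*} :
    Measurable fun (z : (ι → ℝ) × (κ → ℝ)) (p : ι ⊕ κ) => Sum.elim z.1 z.2 p := by
  refine measurable_pi_lambda _ fun p => ?_
  rcases p with i | i
  · exact (measurable_pi_apply i).comp measurable_fst
  · exact (measurable_pi_apply i).comp measurable_snd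

lemma iIndepFun_renewalMeasure (ν η : Measure ℝ) [IsProbabilityMeasure ν]
    [IsProbabilityMeasure η] :
    iIndepFun (fun (p : ℕ ⊕ ℕ) (z : (ℕ → ℝ) × (ℕ → ℝ)) => Sum.elim z.1 z.2 p)
      (renewalMeasure ν η) := by
  have hP : ∀ p : ℕ ⊕ ℕ, IsProbabilityMeasure (Sum.elim (fun _ => ν) (fun _ => η) p) := by
    rintro (i | i) <;> simpa
  have hlaw : (renewalMeasure ν η).map
      (fun (z : (ℕ → ℝ) × (ℕ → ℝ)) (p : ℕ ⊕ ℕ) => Sum.elim z.1 z.2 p) =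
      Measure.infinitePi (Sum.elim (fun _ => ν) (fun _ => η)) := by
    refine Measure.eq_infinitePi _ fun s t ht => ?_
    rw [Measure.map_apply measurable_sumElim (.pi s.countable_toSet fun p _ => ht p)]
    have : (fun (z : (ℕ → ℝ) × (ℕ → ℝ)) (p : ℕ ⊕ ℕ) => Sum.elim z.1 z.2 p) ⁻¹'
        (Set.pi s t) = (Set.pi s.toLeft fun i => t (.inl i)) ×ˢ
          (Set.pi s.toRight fun i => t (.inr i)) := by
      ext z
      simp [Set.mem_pi]
    rw [this, renewalMeasure, Measure.prod_prod, Measure.infinitePi_pi _ fun i _ => ht _,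
      Measure.infinitePi_pi _ fun i _ => ht _, Finset.prod_sum_eq_prod_toLeft_mul_prod_toRight]
    rfl
  refine (iIndepFun_iff_map_fun_eq_infinitePi_map fun p =>
    (measurable_pi_apply p).comp measurable_sumElim).2 ?_
  refine hlaw.trans ?_
  congr 1
  funext p
  have h := Measure.infinitePi_map_eval (Sum.elim (fun _ : ℕ => ν) (fun _ : ℕ => η)) p
  rw [← hlaw, Measure.map_map (measurable_pi_apply p) measurable_sumElim] at h
  exact h.symm

/-- Independence of functions of disjoint subfamilies. -/
lemma indepFun_of_measurable_iSup {Ω ι α β : Type*} {_ : MeasurableSpace Ω} {P : Measure Ω}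
    [MeasurableSpace α] [MeasurableSpace β] {X : ι → Ω → ℝ} (hX : ∀ i, Measurable (X i))
    (h : iIndepFun X P) {S T : Set ι} (hST : Disjoint S T) {U : Ω → α} {V : Ω → β}
    (hU : Measurable[⨆ i ∈ S, MeasurableSpace.comap (X i) inferInstance] U)
    (hV : Measurable[⨆ i ∈ T, MeasurableSpace.comap (X i) inferInstance] V) :
    IndepFun U V P := by
  rw [IndepFun_iff_Indep]
  exact indep_of_indep_of_le_left (indep_of_indep_of_le_right
    (indep_iSup_of_disjoint (fun i => (hX i).comap_le) h hST) hV.comap_le) hU.comap_le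

lemma measurable_iSup_comap {Ω ι : Type*} {X : ι → Ω → ℝ} {S : Set ι} {i : ι} (hi : i ∈ S) :
    Measurable[⨆ i ∈ S, MeasurableSpace.comap (X i) inferInstance] (X i) :=
  (comap_measurable (X i)).mono
    (le_iSup₂ (f := fun i (_ : i ∈ S) => MeasurableSpace.comap (X i) inferInstance) i hi) le_rfl

/-- The first `m` gaps and the first delay. -/
noncomputable def renewalPast (m : ℕ) (z : (ℕ → ℝ) × (ℕ → ℝ)) : (ℕ → ℝ) × ℝ :=
  (fun i => if i < m then z.1 i else 0, z.2 0)

/-- All but the first `m` gaps and the first delay. -/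
def renewalFuture (m : ℕ) (z : (ℕ → ℝ) × (ℕ → ℝ)) : (ℕ → ℝ) × (ℕ → ℝ) :=
  (fun i => z.1 (i + m), fun i => z.2 (i + 1))

lemma measurable_renewalFuture (m : ℕ) : Measurable (renewalFuture m) := by
  unfold renewalFuture; fun_prop

lemma indepFun_renewalPast_renewalFuture (ν η : Measure ℝ) [IsProbabilityMeasure ν]
    [IsProbabilityMeasure η] (m : ℕ) :
    IndepFun (renewalPast m) (renewalFuture m) (renewalMeasure ν η) := by
  refine indepFun_of_measurable_iSup (fun p => (measurable_pi_apply p).comp measurable_sumElim)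
    (iIndepFun_renewalMeasure ν η)
    (S := {p | Sum.elim (· < m) (· < 1) p}) (T := {p | Sum.elim (m ≤ ·) (1 ≤ ·) p}) ?_ ?_ ?_
  · rw [Set.disjoint_left]
    rintro (i | i) h1 h2
    · exact (Nat.not_lt.2 h2) h1
    · exact (Nat.not_lt.2 h2) h1
  · refine @Measurable.prodMk _ _ _ _ _ (_) _ _ (@measurable_pi_lambda _ _ _ (_) _ _ fun i => ?_) ?_
    · by_cases hi : i < m
      · simp only [hi, if_true]
        exact measurable_iSup_comap
          (X := fun (p : ℕ ⊕ ℕ) (z : (ℕ → ℝ) × (ℕ → ℝ)) => Sum.elim z.1 z.2 p) (i := .inl i) hi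
      · simp only [hi, if_false]
        exact @measurable_const _ _ _ (_) _
    · exact measurable_iSup_comap
        (X := fun (p : ℕ ⊕ ℕ) (z : (ℕ → ℝ) × (ℕ → ℝ)) => Sum.elim z.1 z.2 p) (i := .inr 0)
        (zero_lt_one (α := ℕ))
  · refine @Measurable.prodMk _ _ _ _ _ (_) _ _ (@measurable_pi_lambda _ _ _ (_) _ _ fun i => ?_)
      (@measurable_pi_lambda _ _ _ (_) _ _ fun i => ?_)
    · exact measurable_iSup_comap
        (X := fun (p : ℕ ⊕ ℕ) (z : (ℕ → ℝ) × (ℕ → ℝ)) => Sum.elim z.1 z.2 p) (i := .inl (i + m))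
        (Nat.le_add_left m i)
    · exact measurable_iSup_comap
        (X := fun (p : ℕ ⊕ ℕ) (z : (ℕ → ℝ) × (ℕ → ℝ)) => Sum.elim z.1 z.2 p) (i := .inr (i + 1))
        (Nat.le_add_left 1 i)

lemma map_renewalFuture (ν η : Measure ℝ) [IsProbabilityMeasure ν] [IsProbabilityMeasure η]
    (m : ℕ) : (renewalMeasure ν η).map (renewalFuture m) = renewalMeasure ν η := by
  have h : ∀ (μ : Measure ℝ) [IsProbabilityMeasure μ] (m : ℕ),
      (Measure.infinitePi fun _ : ℕ => μ).map (fun ω i => ω (i + m)) =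
        Measure.infinitePi fun _ : ℕ => μ := fun μ _ m =>
    Measure.map_infinitePi_infinitePi_of_inj (P := fun _ : ℕ => μ) (add_left_injective m)
  have := Measure.map_prod_map (Measure.infinitePi fun _ : ℕ => ν)
    (Measure.infinitePi fun _ : ℕ => η) (f := fun (ω : ℕ → ℝ) i => ω (i + m))
    (g := fun (ω : ℕ → ℝ) i => ω (i + 1)) (by fun_prop) (by fun_prop)
  rw [h, h] at this
  exact this.symm

lemma isFirstPassage_renewalPast {z : (ℕ → ℝ) × (ℕ → ℝ)} {m : ℕ} :
    IsFirstPassage (renewalPast (m + 1) z).1 (renewalPast (m + 1) z).2 m ↔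
      IsFirstPassage z.1 (z.2 0) m := by
  have : ∀ i ≤ m, ∑ l ∈ Finset.range (i + 1), (renewalPast (m + 1) z).1 l =
      ∑ l ∈ Finset.range (i + 1), z.1 l := fun i hi =>
    Finset.sum_congr rfl fun l hl => if_pos (by rw [Finset.mem_range] at hl; omega)
  unfold IsFirstPassage
  rw [this m le_rfl]
  exact and_congr Iff.rfl (forall₂_congr fun i hi => by rw [this i hi.le]; rfl)

lemma measure_eq_tsum_of_forall_exists {Ω : Type*} [MeasurableSpace Ω] {P : Measure Ω}
    {H : ℕ → Set Ω} (hm : ∀ m, MeasurableSet (H m)) (hd : Pairwise (Function.onFun Disjoint H))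
    (hH : ∀ᵐ ω ∂P, ∃ m, ω ∈ H m) {A : Set Ω} (hA : MeasurableSet A) :
    P A = ∑' m, P (A ∩ H m) := by
  rw [← measure_iUnion (fun i j hij => (hd hij).mono Set.inter_subset_right Set.inter_subset_right)
    fun m => hA.inter (hm m), ← Set.inter_iUnion]
  refine measure_congr ?_
  filter_upwards [hH] with ω hω
  exact propext ⟨fun h => ⟨h, Set.mem_iUnion.2 hω⟩, fun h => h.1⟩

/-- The strong Markov property at the first selected renewal. -/
lemma map_thinGap_thinStep (ν η : Measure ℝ) [IsProbabilityMeasure ν] [IsProbabilityMeasure η]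
    (h : ∀ᵐ z ∂renewalMeasure ν η, ∃ m, IsFirstPassage z.1 (z.2 0) m) :
    (renewalMeasure ν η).map (fun z => (thinGap z, thinStep z)) =
      ((renewalMeasure ν η).map thinGap).prod (renewalMeasure ν η) := by
  set Q := renewalMeasure ν η
  have : IsProbabilityMeasure (Q.map thinGap) :=
    Measure.isProbabilityMeasure_map measurable_thinGap.aemeasurable
  set H : ℕ → Set ((ℕ → ℝ) × (ℕ → ℝ)) := fun m => {z | IsFirstPassage z.1 (z.2 0) m}
  have hH : ∀ m, MeasurableSet (H m) := fun m =>
    (measurableSet_isFirstPassage m).preimage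
      (f := fun z : (ℕ → ℝ) × (ℕ → ℝ) => (z.1, z.2 0)) (by fun_prop)
  have hdisj : Pairwise (Function.onFun Disjoint H) := by
    intro i j hij
    refine Set.disjoint_left.2 fun z hi hj => hij ?_
    rw [← IsFirstPassage.passageIndex_eq hi, ← IsFirstPassage.passageIndex_eq hj]
  refine (Measure.prod_eq fun A B hA hB => ?_).symm
  rw [Measure.map_apply (measurable_thinGap.prodMk measurable_thinStep) (hA.prod hB),
    Measure.map_apply measurable_thinGap hA]
  rw [measure_eq_tsum_of_forall_exists hH hdisj h
    ((measurable_thinGap.prodMk measurable_thinStep) (hA.prod hB)),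
    measure_eq_tsum_of_forall_exists hH hdisj h (measurable_thinGap hA), ← ENNReal.tsum_mul_right]
  refine tsum_congr fun m => ?_
  -- On passage at index `m`, the selected gap depends only on the first `m + 1` gaps and the first
  -- delay, while `thinStep` is the deterministic shift `renewalFuture (m + 1)`. The two are
  -- independent and the shift preserves the law, so each term factors.
  set E : Set ((ℕ → ℝ) × ℝ) := {p | IsFirstPassage p.1 p.2 m} ∩
    {p | ∑ i ∈ Finset.range (m + 1), p.1 i ∈ A}
  have hE : MeasurableSet E := (measurableSet_isFirstPassage m).inter
    (hA.preimage (Finset.measurable_sum _ fun i _ => by fun_prop))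
  have hEH : thinGap ⁻¹' A ∩ H m = renewalPast (m + 1) ⁻¹' E := by
    ext z
    have hs : ∑ l ∈ Finset.range (m + 1), (renewalPast (m + 1) z).1 l =
        ∑ l ∈ Finset.range (m + 1), z.1 l :=
      Finset.sum_congr rfl fun l hl => if_pos (Finset.mem_range.1 hl)
    change thinGap z ∈ A ∧ IsFirstPassage z.1 (z.2 0) m ↔
      IsFirstPassage (renewalPast (m + 1) z).1 (renewalPast (m + 1) z).2 m ∧
        ∑ l ∈ Finset.range (m + 1), (renewalPast (m + 1) z).1 l ∈ A
    rw [isFirstPassage_renewalPast, hs, and_comm]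
    refine and_congr_right fun hz => ?_
    rw [thinGap, hz.passageIndex_eq]
  have hEB : (fun z => (thinGap z, thinStep z)) ⁻¹' A ×ˢ B ∩ H m =
      renewalPast (m + 1) ⁻¹' E ∩ renewalFuture (m + 1) ⁻¹' B := by
    rw [← hEH]
    ext z
    change (thinGap z ∈ A ∧ thinStep z ∈ B) ∧ IsFirstPassage z.1 (z.2 0) m ↔
      (thinGap z ∈ A ∧ IsFirstPassage z.1 (z.2 0) m) ∧ renewalFuture (m + 1) z ∈ B
    rw [and_right_comm]
    refine and_congr_right fun hz => ?_
    rw [thinStep, hz.2.passageIndex_eq]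
    rfl
  rw [hEB, hEH, (indepFun_renewalPast_renewalFuture ν η (m + 1)).measure_inter_preimage_eq_mul
    _ _ hE hB, ← Measure.map_apply (measurable_renewalFuture _) hB, map_renewalFuture]

/-- If the first output is independent of the next state and the next state has the same law as
the initial one, then all outputs are independent and identically distributed. -/
lemma map_iterate_eq_infinitePi {Z : Type*} [MeasurableSpace Z] {Q : Measure Z}
    [IsProbabilityMeasure Q] {g : Z → ℝ} {T : Z → Z} (hg : Measurable g) (hT : Measurable T)
    (h : Q.map (fun z => (g z, T z)) = (Q.map g).prod Q) :
    Q.map (fun z k => g (T^[k] z)) = Measure.infinitePi fun _ : ℕ => Q.map g := by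
  have : IsProbabilityMeasure (Q.map g) := Measure.isProbabilityMeasure_map hg.aemeasurable
  have hmeas : Measurable fun z k => g (T^[k] z) :=
    measurable_pi_lambda _ fun k => hg.comp (hT.iterate k)
  have key : ∀ (K : ℕ) (t : ℕ → Set ℝ), (∀ k, MeasurableSet (t k)) →
      Q {z | ∀ k < K, g (T^[k] z) ∈ t k} = ∏ k ∈ Finset.range K, Q.map g (t k) := by
    intro K
    induction K with
    | zero => intro t _; simp
    | succ K ih =>
      intro t ht
      have hm : MeasurableSet {z | ∀ k < K, g (T^[k] z) ∈ t (k + 1)} := by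
        have : {z | ∀ k < K, g (T^[k] z) ∈ t (k + 1)} =
            ⋂ k, ⋂ (_ : k < K), {z | g (T^[k] z) ∈ t (k + 1)} := by ext; simp
        rw [this]
        exact .iInter fun k => .iInter fun _ => hg.comp (hT.iterate k) (ht (k + 1))
      have e : {z | ∀ k < K + 1, g (T^[k] z) ∈ t k} =
          (fun z => (g z, T z)) ⁻¹' (t 0 ×ˢ {z | ∀ k < K, g (T^[k] z) ∈ t (k + 1)}) := by
        ext z
        change (∀ k < K + 1, g (T^[k] z) ∈ t k) ↔
          g z ∈ t 0 ∧ ∀ k < K, g (T^[k] (T z)) ∈ t (k + 1)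
        constructor
        · exact fun h => ⟨h 0 (by omega), fun k hk => by
            rw [← Function.iterate_succ_apply]; exact h (k + 1) (by omega)⟩
        · rintro ⟨h0, h1⟩ (_ | k) hk
          · exact h0
          · rw [Function.iterate_succ_apply]; exact h1 k (by omega)
      rw [e, ← Measure.map_apply (hg.prodMk hT) ((ht 0).prod hm), h, Measure.prod_prod,
        ih (fun k => t (k + 1)) fun k => ht (k + 1), Finset.prod_range_succ', mul_comm]
  refine Measure.eq_infinitePi _ fun s t ht => ?_
  classical
  rw [Measure.map_apply hmeas (.pi s.countable_toSet fun k _ => ht k)]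
  obtain ⟨K, hK⟩ : ∃ K, ∀ k ∈ s, k < K :=
    ⟨s.sup id + 1, fun k hk => Nat.lt_succ_of_le (Finset.le_sup (f := id) hk)⟩
  -- A cylinder over a finite set is padded with trivial constraints to one over an initial segment.
  have h1 := key K (fun k => if k ∈ s then t k else Set.univ) fun k => by
    split_ifs
    · exact ht k
    · exact .univ
  have e : (fun z k => g (T^[k] z)) ⁻¹' Set.pi s t =
      {z | ∀ k < K, g (T^[k] z) ∈ if k ∈ s then t k else Set.univ} := by
    ext z
    change (∀ k ∈ s, g (T^[k] z) ∈ t k) ↔ ∀ k < K, g (T^[k] z) ∈ if k ∈ s then t k else Set.univ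
    constructor
    · intro h k _
      split_ifs with hk
      · exact h k hk
      · trivial
    · intro h k hk
      simpa [hk] using h k (hK k hk)
  rw [e, h1]
  have hsub : s ⊆ Finset.range K := fun k hk => Finset.mem_range.2 (hK k hk)
  rw [← Finset.prod_subset hsub]
  · exact Finset.prod_congr rfl fun k hk => by rw [if_pos hk]
  · intro k _ hk
    rw [if_neg hk, measure_univ]

lemma measurePreserving_of_map_prodMk {Z : Type*} [MeasurableSpace Z] {Q : Measure Z}
    [IsProbabilityMeasure Q] {g : Z → ℝ} {T : Z → Z} (hg : Measurable g) (hT : Measurable T)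
    (h : Q.map (fun z => (g z, T z)) = (Q.map g).prod Q) : MeasurePreserving T Q Q := by
  have : IsProbabilityMeasure (Q.map g) := Measure.isProbabilityMeasure_map hg.aemeasurable
  refine ⟨hT, ?_⟩
  have h1 := congrArg Measure.snd h
  rwa [Measure.snd_prod, Measure.snd, Measure.map_map measurable_snd (hg.prodMk hT)] at h1

/-! ### Laplace transforms and integrals over the renewal measure -/

instance : IsProbabilityMeasure (expMeasure 1) := isProbabilityMeasure_expMeasure one_pos

/-- The integral of `exp (-s t)` over `0 ≤ t ≤ x`. -/
noncomputable def expIntegral (s x : ℝ) : ℝ := ∫ t in (0 : ℝ)..x, Real.exp (-(s * t))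

lemma continuous_exp_neg_mul (s : ℝ) : Continuous fun t => Real.exp (-(s * t)) := by fun_prop

lemma expIntegral_add (s x y : ℝ) :
    expIntegral s (x + y) = expIntegral s x + Real.exp (-(s * x)) * expIntegral s y := by
  have h := continuous_exp_neg_mul s
  unfold expIntegral
  rw [← intervalIntegral.integral_add_adjacent_intervals (h.intervalIntegrable 0 x)
    (h.intervalIntegrable x (x + y)), ← intervalIntegral.integral_const_mul]
  congr 1
  have := intervalIntegral.integral_comp_add_left (fun t => Real.exp (-(s * t))) x (a := 0) (b := y)
  rw [add_zero] at this
  rw [← this]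
  congr 1
  funext t
  rw [← Real.exp_add]
  ring_nf

lemma expIntegral_zero_left (x : ℝ) : expIntegral 0 x = x := by simp [expIntegral]

lemma expIntegral_zero_right (s : ℝ) : expIntegral s 0 = 0 := by simp [expIntegral]

lemma expIntegral_nonneg (s : ℝ) {x : ℝ} (hx : 0 ≤ x) : 0 ≤ expIntegral s x :=
  intervalIntegral.integral_nonneg hx fun _ _ => (Real.exp_pos _).le

/-- Links `expIntegral` to the Laplace transform. Unlike `1 - exp (-(s x))`, the integral stays
informative at `s = 0`, where it equals `x`, so one recursion covers transforms and means. -/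
lemma mul_expIntegral (s x : ℝ) : s * expIntegral s x = 1 - Real.exp (-(s * x)) := by
  have hd : ∀ t ∈ Set.uIcc 0 x,
      HasDerivAt (fun t => -Real.exp (-(s * t))) (s * Real.exp (-(s * t))) t := by
    intro t _
    refine ((((hasDerivAt_id t).const_mul s).neg.exp).neg).congr_deriv ?_
    simp; ring
  unfold expIntegral
  rw [← intervalIntegral.integral_const_mul, intervalIntegral.integral_eq_sub_of_hasDerivAt hd
    ((continuous_const.mul (continuous_exp_neg_mul s)).intervalIntegrable 0 x)]
  simp; ring

lemma measurable_expIntegral (s : ℝ) : Measurable (expIntegral s) :=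
  (intervalIntegral.continuous_primitive
    (fun a b => (continuous_exp_neg_mul s).intervalIntegrable a b) 0).measurable

lemma expIntegral_sum (s : ℝ) (d : ℕ → ℝ) (n : ℕ) :
    expIntegral s (∑ i ∈ Finset.range n, d i) =
      ∑ m ∈ Finset.range n, Real.exp (-(s * ∑ i ∈ Finset.range m, d i)) * expIntegral s (d m) := by
  induction n with
  | zero => simp [expIntegral_zero_right]
  | succ n ih => rw [Finset.sum_range_succ, expIntegral_add, ih, Finset.sum_range_succ]

lemma expMeasure_one_Ici {c : ℝ} (hc : 0 ≤ c) :
    expMeasure 1 (Set.Ici c) = ENNReal.ofReal (Real.exp (-c)) := by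
  have h : expMeasure 1 (Set.Iio c) = ENNReal.ofReal (1 - Real.exp (-c)) := by
    rw [expMeasure, gammaMeasure, withDensity_apply _ measurableSet_Iio,
      setLIntegral_congr Iio_ae_eq_Iic]
    have := lintegral_exponentialPDF_eq_antiDeriv one_pos c
    rw [if_pos hc, one_mul] at this
    exact this
  rw [← Set.compl_Iio, prob_compl_eq_one_sub measurableSet_Iio, h, ← ENNReal.ofReal_one,
    ← ENNReal.ofReal_sub _ (by simpa using hc)]
  ring_nf

lemma ae_expMeasure_pos : ∀ᵐ x ∂expMeasure 1, 0 < x := by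
  rw [ae_iff]
  have : {x : ℝ | ¬0 < x} = Set.Iic 0 := by ext; simp
  rw [this, expMeasure, gammaMeasure, withDensity_apply _ measurableSet_Iic]
  refine (lintegral_exponentialPDF_eq_antiDeriv one_pos 0).trans ?_
  simp

lemma lintegral_expIntegral_expMeasure {s : ℝ} (hs : 0 ≤ s) :
    ∫⁻ x, ENNReal.ofReal (expIntegral s x) ∂expMeasure 1 = ENNReal.ofReal (1 / (s + 1)) := by
  -- Layer-cake formula: the tail `exp (-t)` is integrated against `exp (-(s t))`.
  have h := lintegral_comp_eq_lintegral_meas_le_mul (expMeasure 1) (f := id)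
    (g := fun t => Real.exp (-(s * t))) (ae_expMeasure_pos.mono fun x hx => hx.le)
    aemeasurable_id (fun t _ => (continuous_exp_neg_mul s).intervalIntegrable 0 t)
    (ae_of_all _ fun t => (Real.exp_pos _).le)
  refine h.trans ?_
  have h2 : ∀ t ∈ Set.Ioi (0 : ℝ), expMeasure 1 {a | t ≤ id a} *
      ENNReal.ofReal (Real.exp (-(s * t))) = ENNReal.ofReal (Real.exp (-(s + 1) * t)) := by
    intro t ht
    have : {a : ℝ | t ≤ id a} = Set.Ici t := rfl
    rw [this, expMeasure_one_Ici (le_of_lt ht), ← ENNReal.ofReal_mul (Real.exp_pos _).le,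
      ← Real.exp_add]
    ring_nf
  rw [setLIntegral_congr_fun measurableSet_Ioi h2, ← ofReal_integral_eq_lintegral_ofReal]
  · rw [integral_exp_mul_Ioi (by linarith)]
    rw [mul_zero, Real.exp_zero, neg_div_neg_eq]
  · exact integrableOn_exp_mul_Ioi (by linarith) 0
  · exact ae_of_all _ fun t => (Real.exp_pos _).le

/-- The Laplace transform of `ν`. -/
noncomputable def laplace (ν : Measure ℝ) (s : ℝ) : ENNReal :=
  ∫⁻ x, ENNReal.ofReal (Real.exp (-(s * x))) ∂ν

lemma laplace_add {ν : Measure ℝ} [IsProbabilityMeasure ν] (hν : ∀ᵐ x ∂ν, 0 < x) {s : ℝ}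
    (hs : 0 ≤ s) :
    laplace ν s + ENNReal.ofReal s * ∫⁻ x, ENNReal.ofReal (expIntegral s x) ∂ν = 1 := by
  rw [laplace, ← lintegral_const_mul _ (measurable_expIntegral s).ennreal_ofReal,
    ← lintegral_add_left (by fun_prop)]
  rw [lintegral_congr_ae (g := fun _ => 1), lintegral_one, measure_univ]
  filter_upwards [hν] with x hx
  rw [← ENNReal.ofReal_mul hs, mul_expIntegral, ← ENNReal.ofReal_add (Real.exp_pos _).le]
  · simp
  · have : 0 ≤ s * x := by positivity
    simpa using this

lemma one_sub_laplace {ν : Measure ℝ} [IsProbabilityMeasure ν] (hν : ∀ᵐ x ∂ν, 0 < x) {s : ℝ}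
    (hs : 0 ≤ s) :
    1 - laplace ν s = ENNReal.ofReal s * ∫⁻ x, ENNReal.ofReal (expIntegral s x) ∂ν := by
  have h := laplace_add hν hs
  refine ENNReal.sub_eq_of_eq_add_rev ?_ h.symm
  exact ne_top_of_le_ne_top ENNReal.one_ne_top (h ▸ le_self_add)

lemma laplace_lt_one {ν : Measure ℝ} [IsProbabilityMeasure ν] (hν : ∀ᵐ x ∂ν, 0 < x) {s : ℝ}
    (hs : 0 < s) : laplace ν s < 1 := by
  have h := laplace_add hν hs.le
  have hle : laplace ν s ≤ 1 := h ▸ le_self_add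
  refine lt_of_le_of_ne hle fun h1 => ?_
  rw [h1] at h
  have h2 : ENNReal.ofReal s * ∫⁻ x, ENNReal.ofReal (expIntegral s x) ∂ν = 0 := by
    have h3 := ENNReal.sub_eq_of_eq_add_rev ENNReal.one_ne_top h.symm
    rw [← h3, tsub_self]
  rw [mul_eq_zero, lintegral_eq_zero_iff (measurable_expIntegral s).ennreal_ofReal] at h2
  rcases h2 with h2 | h2
  · exact absurd (ENNReal.ofReal_eq_zero.1 h2) (not_le.2 hs)
  · obtain ⟨x, hx, hx0⟩ := (hν.and h2).exists
    have h4 : expIntegral s x ≤ 0 := ENNReal.ofReal_eq_zero.1 hx0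
    have h5 := mul_expIntegral s x
    have h6 : Real.exp (-(s * x)) < 1 := Real.exp_lt_one_iff.2 (by nlinarith)
    nlinarith

lemma ae_infinitePi_forall {ν : Measure ℝ} [IsProbabilityMeasure ν] {p : ℝ → Prop}
    (h : ∀ᵐ x ∂ν, p x) {ι : Type*} [Countable ι] :
    ∀ᵐ d ∂Measure.infinitePi fun _ : ι => ν, ∀ i, p (d i) := by
  rw [ae_all_iff]
  exact fun i => (measurePreserving_eval_infinitePi (fun _ : ι => ν) i).quasiMeasurePreserving.ae h

lemma lintegral_prod_mul_infinitePi (ν : Measure ℝ) [IsProbabilityMeasure ν]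
    {f g : ℝ → ENNReal} (hf : Measurable f) (hg : Measurable g) (m : ℕ) :
    ∫⁻ d, (∏ i ∈ Finset.range m, f (d i)) * g (d m) ∂Measure.infinitePi (fun _ : ℕ => ν) =
      (∫⁻ x, f x ∂ν) ^ m * ∫⁻ x, g x ∂ν := by
  set X : ℕ → ℝ → ENNReal := fun i => if i < m then f else g
  have hX : ∀ i, Measurable (X i) := fun i => by
    simp only [X]; split_ifs <;> assumption
  have h := lintegral_prod_eq_prod_lintegral_of_indepFun (Finset.range (m + 1))
    (fun i (d : ℕ → ℝ) => X i (d i))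
    (iIndepFun_infinitePi (P := fun _ : ℕ => ν) hX)
    (fun i => (hX i).comp (measurable_pi_apply i))
  have h1 : ∀ i, ∫⁻ d, X i (d i) ∂Measure.infinitePi (fun _ : ℕ => ν) = ∫⁻ x, X i x ∂ν := fun i =>
    (measurePreserving_eval_infinitePi (fun _ : ℕ => ν) i).lintegral_comp (hX i)
  have h2 : ∀ i ∈ Finset.range m, X i = f := fun i hi => if_pos (Finset.mem_range.1 hi)
  have h3 : X m = g := if_neg (lt_irrefl m)
  simp_rw [Finset.prod_range_succ, h1, h3] at h
  rw [Finset.prod_congr rfl fun i hi => by rw [h2 i hi], Finset.prod_const,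
    Finset.card_range] at h
  rw [← h]
  refine lintegral_congr fun d => ?_
  congr 1
  exact Finset.prod_congr rfl fun i hi => by rw [h2 i hi]

lemma exp_neg_mul_sum (s : ℝ) (d : ℕ → ℝ) (m : ℕ) :
    ENNReal.ofReal (Real.exp (-(s * ∑ i ∈ Finset.range m, d i))) =
      ∏ i ∈ Finset.range m, ENNReal.ofReal (Real.exp (-(s * d i))) := by
  rw [← ENNReal.ofReal_prod_of_nonneg fun i _ => (Real.exp_pos _).le, ← Real.exp_sum,
    Finset.sum_neg_distrib, Finset.mul_sum]

/-- Integration over the first delay and then over the gaps. -/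
lemma lintegral_renewalMeasure_indicator {ν : Measure ℝ} [IsProbabilityMeasure ν]
    (hν : ∀ᵐ x ∂ν, 0 < x) (s : ℝ) {g : ℝ → ENNReal} (hg : Measurable g) (m : ℕ) :
    ∫⁻ z, {z : (ℕ → ℝ) × (ℕ → ℝ) | ∑ i ∈ Finset.range m, z.1 i ≤ z.2 0}.indicator
        (fun z => ENNReal.ofReal (Real.exp (-(s * ∑ i ∈ Finset.range m, z.1 i))) * g (z.1 m)) z
        ∂renewalMeasure ν (expMeasure 1) =
      laplace ν (s + 1) ^ m * ∫⁻ x, g x ∂ν := by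
  have hsum : Measurable fun d : ℕ → ℝ => ∑ i ∈ Finset.range m, d i :=
    Finset.measurable_sum _ fun i _ => measurable_pi_apply i
  have hset : MeasurableSet
      {z : (ℕ → ℝ) × (ℕ → ℝ) | ∑ i ∈ Finset.range m, z.1 i ≤ z.2 0} :=
    measurableSet_le (hsum.comp measurable_fst) (by fun_prop)
  have hG : Measurable fun d : ℕ → ℝ =>
      ENNReal.ofReal (Real.exp (-(s * ∑ i ∈ Finset.range m, d i))) * g (d m) :=
    (Real.measurable_exp.comp (hsum.const_mul s).neg).ennreal_ofReal.mul
      (hg.comp (measurable_pi_apply m))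
  have hF : Measurable
      ({z : (ℕ → ℝ) × (ℕ → ℝ) | ∑ i ∈ Finset.range m, z.1 i ≤ z.2 0}.indicator
        fun z => ENNReal.ofReal (Real.exp (-(s * ∑ i ∈ Finset.range m, z.1 i))) * g (z.1 m)) :=
    (hG.comp measurable_fst).indicator hset
  rw [renewalMeasure, lintegral_prod _ hF.aemeasurable]
  -- For fixed gaps, the delay is at least their sum with probability `exp (-∑ d i)`; this factor
  -- shifts `s` to `s + 1`, and the result is a product over independent gaps.
  have hinner : ∀ᵐ d ∂Measure.infinitePi (fun _ : ℕ => ν),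
      ∫⁻ e, {z : (ℕ → ℝ) × (ℕ → ℝ) | ∑ i ∈ Finset.range m, z.1 i ≤ z.2 0}.indicator
        (fun z => ENNReal.ofReal (Real.exp (-(s * ∑ i ∈ Finset.range m, z.1 i))) * g (z.1 m))
        (d, e) ∂Measure.infinitePi (fun _ : ℕ => expMeasure 1) =
      (∏ i ∈ Finset.range m, ENNReal.ofReal (Real.exp (-((s + 1) * d i)))) * g (d m) := by
    filter_upwards [ae_infinitePi_forall hν (ι := ℕ)] with d hd
    have hd0 : 0 ≤ ∑ i ∈ Finset.range m, d i := Finset.sum_nonneg fun i _ => (hd i).le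
    have e1 : ∀ e : ℕ → ℝ,
        {z : (ℕ → ℝ) × (ℕ → ℝ) | ∑ i ∈ Finset.range m, z.1 i ≤ z.2 0}.indicator
          (fun z => ENNReal.ofReal (Real.exp (-(s * ∑ i ∈ Finset.range m, z.1 i))) * g (z.1 m))
          (d, e) =
        (Set.Ici (∑ i ∈ Finset.range m, d i)).indicator (fun _ =>
          ENNReal.ofReal (Real.exp (-(s * ∑ i ∈ Finset.range m, d i))) * g (d m)) (e 0) :=
      fun e => rfl
    simp_rw [e1]
    rw [(measurePreserving_eval_infinitePi (fun _ : ℕ => expMeasure 1) 0).lintegral_comp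
      (f := (Set.Ici (∑ i ∈ Finset.range m, d i)).indicator fun _ =>
        ENNReal.ofReal (Real.exp (-(s * ∑ i ∈ Finset.range m, d i))) * g (d m))
      (measurable_const.indicator measurableSet_Ici), lintegral_indicator_const measurableSet_Ici,
      expMeasure_one_Ici hd0, mul_right_comm, ← ENNReal.ofReal_mul (Real.exp_pos _).le,
      ← Real.exp_add, ← exp_neg_mul_sum]
    ring_nf
  rw [lintegral_congr_ae hinner]
  exact lintegral_prod_mul_infinitePi ν
    (f := fun x => ENNReal.ofReal (Real.exp (-((s + 1) * x)))) (by fun_prop) hg m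

lemma ae_renewalMeasure_pos {ν η : Measure ℝ} [IsProbabilityMeasure ν] [IsProbabilityMeasure η]
    (hν : ∀ᵐ x ∂ν, 0 < x) (hη : ∀ᵐ x ∂η, 0 < x) :
    ∀ᵐ z ∂renewalMeasure ν η, (∀ k, 0 < z.1 k) ∧ ∀ k, 0 < z.2 k :=
  (Measure.quasiMeasurePreserving_fst.ae (ae_infinitePi_forall hν)).and
    (Measure.quasiMeasurePreserving_snd.ae (ae_infinitePi_forall hη))

/-- The first `m + 1` gaps fail to exceed the delay with probability `laplace ν 1 ^ (m + 1)`, which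
tends to zero because positive gaps force `laplace ν 1 < 1`. -/
lemma ae_exists_isFirstPassage {ν : Measure ℝ} [IsProbabilityMeasure ν]
    (hν : ∀ᵐ x ∂ν, 0 < x) :
    ∀ᵐ z ∂renewalMeasure ν (expMeasure 1), ∃ m, IsFirstPassage z.1 (z.2 0) m := by
  rw [ae_iff]
  have hb : ∀ m : ℕ, renewalMeasure ν (expMeasure 1)
      {z | ¬∃ m, IsFirstPassage z.1 (z.2 0) m} ≤ laplace ν 1 ^ (m + 1) := by
    intro m
    have h := lintegral_renewalMeasure_indicator hν 0 (g := fun _ => 1) measurable_const (m + 1)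
    have hset : MeasurableSet
        {z : (ℕ → ℝ) × (ℕ → ℝ) | ∑ i ∈ Finset.range (m + 1), z.1 i ≤ z.2 0} :=
      measurableSet_le ((Finset.measurable_sum _ fun i _ => measurable_pi_apply i).comp
        measurable_fst) (by fun_prop)
    simp only [zero_mul, neg_zero, Real.exp_zero, ENNReal.ofReal_one, mul_one, lintegral_one,
      measure_univ, zero_add] at h
    rw [lintegral_indicator_const hset, one_mul] at h
    rw [← h]
    refine measure_mono fun z hz => ?_
    by_contra hc
    exact hz (exists_isFirstPassage_iff.2 ⟨m, not_le.1 hc⟩)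
  have ht := (ENNReal.tendsto_pow_atTop_nhds_zero_of_lt_one (laplace_lt_one hν one_pos)).comp
    (Filter.tendsto_add_atTop_nat 1)
  exact le_antisymm (ge_of_tendsto' ht hb) zero_le

/-- The integral up to the selected renewal is cut at the partial sums. The `m`-th piece occurs
exactly when the sum of the first `m` gaps is at most the delay, and the expectations of the pieces
form a geometric series of ratio `laplace ν (s + 1)`. -/
lemma lintegral_expIntegral_thinGap {ν : Measure ℝ} [IsProbabilityMeasure ν]
    (hν : ∀ᵐ x ∂ν, 0 < x) (s : ℝ) :
    ∫⁻ x, ENNReal.ofReal (expIntegral s x) ∂(renewalMeasure ν (expMeasure 1)).map thinGap =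
      (∫⁻ x, ENNReal.ofReal (expIntegral s x) ∂ν) * (1 - laplace ν (s + 1))⁻¹ := by
  rw [lintegral_map (measurable_expIntegral s).ennreal_ofReal measurable_thinGap]
  have key : ∀ᵐ z ∂renewalMeasure ν (expMeasure 1),
      ENNReal.ofReal (expIntegral s (thinGap z)) =
      ∑' m, {z : (ℕ → ℝ) × (ℕ → ℝ) | ∑ i ∈ Finset.range m, z.1 i ≤ z.2 0}.indicator
        (fun z => ENNReal.ofReal (Real.exp (-(s * ∑ i ∈ Finset.range m, z.1 i))) *
          ENNReal.ofReal (expIntegral s (z.1 m))) z := by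
    filter_upwards [ae_renewalMeasure_pos hν ae_expMeasure_pos, ae_exists_isFirstPassage hν]
      with z hz hN
    obtain ⟨N, hN⟩ := hN
    have hmono : StrictMono fun m => ∑ i ∈ Finset.range m, z.1 i :=
      strictMono_nat_of_lt_succ fun m => by rw [Finset.sum_range_succ]; linarith [hz.1 m]
    rw [thinGap, hN.passageIndex_eq, expIntegral_sum, ENNReal.ofReal_sum_of_nonneg fun m _ =>
      mul_nonneg (Real.exp_pos _).le (expIntegral_nonneg s (hz.1 m).le),
      tsum_eq_sum (s := Finset.range (N + 1))]
    · refine Finset.sum_congr rfl fun m hm => ?_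
      rw [Set.indicator_of_mem, ENNReal.ofReal_mul (Real.exp_pos _).le]
      change ∑ i ∈ Finset.range m, z.1 i ≤ z.2 0
      rcases m with _ | m
      · simpa using (hz.2 0).le
      · exact hN.2 m (by rw [Finset.mem_range] at hm; omega)
    · intro m hm
      refine Set.indicator_of_notMem (fun h => ?_) _
      have h1 : N + 1 ≤ m := by rw [Finset.mem_range] at hm; omega
      exact absurd (hN.1.trans_le (hmono.monotone h1)) (not_lt.2 h)
  have hmeas : ∀ m : ℕ, Measurable
      ({z : (ℕ → ℝ) × (ℕ → ℝ) | ∑ i ∈ Finset.range m, z.1 i ≤ z.2 0}.indicator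
        (fun z => ENNReal.ofReal (Real.exp (-(s * ∑ i ∈ Finset.range m, z.1 i))) *
          ENNReal.ofReal (expIntegral s (z.1 m)))) := by
    intro m
    have hsum : Measurable fun z : (ℕ → ℝ) × (ℕ → ℝ) => ∑ i ∈ Finset.range m, z.1 i :=
      (Finset.measurable_sum _ fun i _ => measurable_pi_apply i).comp measurable_fst
    refine Measurable.indicator ?_ (measurableSet_le hsum (by fun_prop))
    exact (Real.measurable_exp.comp (hsum.const_mul s).neg).ennreal_ofReal.mul
      ((measurable_expIntegral s).ennreal_ofReal.comp (by fun_prop))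
  rw [lintegral_congr_ae key, lintegral_tsum fun m => (hmeas m).aemeasurable,
    tsum_congr fun m => lintegral_renewalMeasure_indicator hν s
      (measurable_expIntegral s).ennreal_ofReal m, ENNReal.tsum_mul_right, ENNReal.tsum_geometric,
    mul_comm]

lemma ae_map_thinGap_pos {ν η : Measure ℝ} [IsProbabilityMeasure ν] [IsProbabilityMeasure η]
    (hν : ∀ᵐ x ∂ν, 0 < x) (hη : ∀ᵐ x ∂η, 0 < x) :
    ∀ᵐ x ∂(renewalMeasure ν η).map thinGap, 0 < x := by
  rw [ae_map_iff measurable_thinGap.aemeasurable measurableSet_Ioi]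
  filter_upwards [ae_renewalMeasure_pos hν hη] with z hz
  exact thin_pos hz.1 0

lemma map_thin {ν : Measure ℝ} [IsProbabilityMeasure ν] (hν : ∀ᵐ x ∂ν, 0 < x) :
    (renewalMeasure ν (expMeasure 1)).map thin =
      Measure.infinitePi fun _ : ℕ => (renewalMeasure ν (expMeasure 1)).map thinGap :=
  map_iterate_eq_infinitePi measurable_thinGap measurable_thinStep
    (map_thinGap_thinStep ν _ (ae_exists_isFirstPassage hν))

/-- `thinStep` preserves the renewal measure, so almost sure passage for the first delay carries
over to every later one. -/
lemma ae_thinnable {ν : Measure ℝ} [IsProbabilityMeasure ν] (hν : ∀ᵐ x ∂ν, 0 < x) :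
    ∀ᵐ z ∂renewalMeasure ν (expMeasure 1), Thinnable z := by
  refine ae_all_iff.2 fun k => ?_
  exact ((measurePreserving_of_map_prodMk measurable_thinGap measurable_thinStep
    (map_thinGap_thinStep ν _ (ae_exists_isFirstPassage hν))).iterate k).quasiMeasurePreserving.ae
      (ae_exists_isFirstPassage hν)

/-! ### Transform and mean of the gap laws -/

/-- The law of the gaps between the receptions at distance `j` from the rightmost node. -/
noncomputable def gapLaw : ℕ → Measure ℝ
  | 0 => expMeasure 1
  | j + 1 => (renewalMeasure (gapLaw j) (expMeasure 1)).map thinGap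

instance (j : ℕ) : IsProbabilityMeasure (gapLaw j) := by
  induction j with
  | zero => exact isProbabilityMeasure_expMeasure one_pos
  | succ j ih => exact Measure.isProbabilityMeasure_map measurable_thinGap.aemeasurable

lemma ae_gapLaw_pos (j : ℕ) : ∀ᵐ x ∂gapLaw j, 0 < x := by
  induction j with
  | zero => exact ae_expMeasure_pos
  | succ j ih => exact ae_map_thinGap_pos ih ae_expMeasure_pos

lemma lintegral_expIntegral_gapLaw (j : ℕ) {s : ℝ} (hs : 0 < s) :
    ∫⁻ x, ENNReal.ofReal (expIntegral s x) ∂gapLaw j =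
      ENNReal.ofReal (Real.exp (-betaIntegral j s) / s) := by
  induction j generalizing s with
  | zero =>
    rw [gapLaw, lintegral_expIntegral_expMeasure hs.le, exp_neg_betaIntegral_zero hs]
    congr 1
    field_simp
  | succ j ih =>
    have hs1 : 0 < s + 1 := by linarith
    rw [gapLaw, lintegral_expIntegral_thinGap (ae_gapLaw_pos j),
      one_sub_laplace (ae_gapLaw_pos j) hs1.le, ih hs, ih hs1, ← ENNReal.ofReal_mul hs1.le,
      mul_div_cancel₀ _ hs1.ne', ← ENNReal.ofReal_inv_of_pos (Real.exp_pos _),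
      ← ENNReal.ofReal_mul (by positivity), betaIntegral_succ hs, neg_sub, ← Real.exp_neg, neg_neg,
      div_mul_eq_mul_div, ← Real.exp_add]
    ring_nf

/-- The recursion at `s = 0` needs the transform only at `1`, so the singularity of `betaIntegral`
at `0` never enters; each node multiplies the mean by `exp (betaIntegral j 1)`. -/
lemma lintegral_gapLaw (j : ℕ) :
    ∫⁻ x, ENNReal.ofReal x ∂gapLaw j =
      ENNReal.ofReal (Real.exp (∑ i ∈ Finset.range j, betaIntegral i 1)) := by
  suffices h : ∫⁻ x, ENNReal.ofReal (expIntegral 0 x) ∂gapLaw j =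
      ENNReal.ofReal (Real.exp (∑ i ∈ Finset.range j, betaIntegral i 1)) by
    simpa only [expIntegral_zero_left] using h
  induction j with
  | zero => rw [gapLaw, lintegral_expIntegral_expMeasure le_rfl]; simp
  | succ j ih =>
    rw [gapLaw, lintegral_expIntegral_thinGap (ae_gapLaw_pos j), ih, zero_add,
      one_sub_laplace (ae_gapLaw_pos j) zero_le_one, lintegral_expIntegral_gapLaw j one_pos,
      ENNReal.ofReal_one, one_mul, div_one, ← ENNReal.ofReal_inv_of_pos (Real.exp_pos _),
      ← ENNReal.ofReal_mul (Real.exp_pos _).le, ← Real.exp_neg, neg_neg, ← Real.exp_add,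
      Finset.sum_range_succ]

/-! ### The canonical random chain -/

/-- The law of independent exponential off-periods. -/
noncomputable def offMeasure : Measure (ℕ × ℕ → ℝ) :=
  Measure.infinitePi fun _ : ℕ × ℕ => expMeasure 1

instance : IsProbabilityMeasure offMeasure := by unfold offMeasure; infer_instance

lemma iIndepFun_offMeasure : iIndepFun (fun (p : ℕ × ℕ) (y : ℕ × ℕ → ℝ) => y p) offMeasure :=
  iIndepFun_infinitePi (P := fun _ : ℕ × ℕ => expMeasure 1) (X := fun _ x => x)
    fun _ => measurable_id

lemma measurable_gaps_iSup (j : ℕ) {T : Set (ℕ × ℕ)} (hT : ∀ l ≤ j, ∀ k, (l, k) ∈ T) :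
    Measurable[⨆ p ∈ T, MeasurableSpace.comap (fun y : ℕ × ℕ → ℝ => y p) inferInstance]
      (gaps j) := by
  induction j with
  | zero =>
    exact @measurable_pi_lambda _ _ _ (_) _ _ fun k =>
      measurable_iSup_comap (X := fun (p : ℕ × ℕ) (y : ℕ × ℕ → ℝ) => y p) (hT 0 le_rfl k)
  | succ j ih =>
    refine measurable_thin.comp
      (@Measurable.prodMk _ _ _ _ _ (_) _ _ (ih fun l hl => hT l (by omega))
        (@measurable_pi_lambda _ _ _ (_) _ _ fun k => ?_))
    exact measurable_iSup_comap (X := fun (p : ℕ × ℕ) (y : ℕ × ℕ → ℝ) => y p)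
      (hT (j + 1) le_rfl k)

lemma map_offMeasure_row (j : ℕ) :
    offMeasure.map (fun y k => y (j, k)) = Measure.infinitePi fun _ : ℕ => expMeasure 1 :=
  Measure.map_infinitePi_infinitePi_of_inj (P := fun _ : ℕ × ℕ => expMeasure 1)
    (f := fun k : ℕ => (j, k)) fun _ _ h => (Prod.mk.inj h).2

/-- The gaps at distance `j` use only the rows up to `j`, hence are independent of row `j + 1`,
which supplies the delays. -/
lemma map_gaps_prodMk {j : ℕ}
    (h : offMeasure.map (gaps j) = Measure.infinitePi fun _ : ℕ => gapLaw j) :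
    offMeasure.map (fun y => (gaps j y, fun k => y (j + 1, k))) =
      renewalMeasure (gapLaw j) (expMeasure 1) := by
  have hrow : Measurable fun (y : ℕ × ℕ → ℝ) (k : ℕ) => y (j + 1, k) := by fun_prop
  have hind : IndepFun (gaps j) (fun (y : ℕ × ℕ → ℝ) (k : ℕ) => y (j + 1, k)) offMeasure := by
    refine indepFun_of_measurable_iSup (fun p => measurable_pi_apply p) iIndepFun_offMeasure
      (S := {p | p.1 ≤ j}) (T := {p | p.1 = j + 1}) ?_ (measurable_gaps_iSup j fun l hl k => hl) ?_
    · refine Set.disjoint_left.2 fun p h1 h2 => ?_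
      have h3 : p.1 ≤ j := h1
      have h4 : p.1 = j + 1 := h2
      omega
    · exact @measurable_pi_lambda _ _ _ (_) _ _ fun k =>
        measurable_iSup_comap (X := fun (p : ℕ × ℕ) (y : ℕ × ℕ → ℝ) => y p)
          (i := (j + 1, k)) (rfl : j + 1 = j + 1)
  rw [(indepFun_iff_map_prod_eq_prod_map_map (measurable_gaps j).aemeasurable
    hrow.aemeasurable).1 hind, h, map_offMeasure_row, renewalMeasure]

lemma map_gaps (j : ℕ) :
    offMeasure.map (gaps j) = Measure.infinitePi fun _ : ℕ => gapLaw j := by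
  induction j with
  | zero => exact map_offMeasure_row 0
  | succ j ih =>
    have h := map_gaps_prodMk ih
    have hm : Measurable fun y : ℕ × ℕ → ℝ => (gaps j y, fun k => y (j + 1, k)) :=
      (measurable_gaps j).prodMk (by fun_prop)
    rw [gapLaw, ← map_thin (ae_gapLaw_pos j), ← h, Measure.map_map measurable_thin hm]
    rfl

lemma ae_isPermanentOnOffPath_gaps (n : ℕ) [NeZero n] :
    ∀ᵐ y ∂offMeasure, IsPermanentOnOffPath (n := n)
      (fun i k => ∑ m ∈ Finset.range k, gaps (n - 1 - i) y m + y (n - 1 - i, k))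
      (fun i k => ∑ m ∈ Finset.range k, gaps (n - 1 - i) y m) := by
  have h1 : ∀ᵐ y ∂offMeasure, ∀ p, 0 < y p := ae_infinitePi_forall ae_expMeasure_pos
  have h2 : ∀ᵐ y ∂offMeasure, ∀ j, Thinnable (gaps j y, fun k => y (j + 1, k)) := by
    refine ae_all_iff.2 fun j => ?_
    have hm : Measurable fun y : ℕ × ℕ → ℝ => (gaps j y, fun k => y (j + 1, k)) :=
      (measurable_gaps j).prodMk (by fun_prop)
    have h3 : MeasurePreserving (fun y : ℕ × ℕ → ℝ => (gaps j y, fun k => y (j + 1, k)))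
        offMeasure (renewalMeasure (gapLaw j) (expMeasure 1)) :=
      ⟨hm, map_gaps_prodMk (map_gaps j)⟩
    exact h3.quasiMeasurePreserving.ae (ae_thinnable (ae_gapLaw_pos j))
  filter_upwards [h1, h2] with y hy hthin using isPermanentOnOffPath_gaps hy hthin

lemma offIndex_injective (n : ℕ) :
    Function.Injective fun p : Fin n × ℕ => (n - 1 - (p.1 : ℕ), p.2) := by
  rintro ⟨i, k⟩ ⟨j, l⟩ h
  obtain ⟨h1, rfl⟩ := Prod.mk.inj h
  have : i = j := Fin.ext (by simp only at h1; omega)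
  rw [this]

lemma isPermanentOnOffSystem_gaps (n : ℕ) [NeZero n] :
    IsPermanentOnOffSystem (n := n) (fun _ => 1) offMeasure
      (fun i k y => ∑ m ∈ Finset.range k, gaps (n - 1 - i) y m + y (n - 1 - i, k))
      (fun i k y => ∑ m ∈ Finset.range k, gaps (n - 1 - i) y m) := by
  have hS : ∀ (i : Fin n) (k : ℕ),
      Measurable fun y : ℕ × ℕ → ℝ => ∑ m ∈ Finset.range k, gaps (n - 1 - i) y m := fun i k =>
    Finset.measurable_sum _ fun m _ => (measurable_pi_apply m).comp (measurable_gaps _)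
  refine ⟨inferInstance, fun i k => ((hS i k).add (measurable_pi_apply _)).aemeasurable,
    fun i k => (hS i k).aemeasurable, ae_isPermanentOnOffPath_gaps n, fun i k => ?_, ?_⟩
  · simp only [add_sub_cancel_left]
    exact ⟨(measurable_pi_apply _).aemeasurable,
      Measure.infinitePi_map_eval (fun _ : ℕ × ℕ => expMeasure 1) _⟩
  · simp only [add_sub_cancel_left]
    exact iIndepFun_offMeasure.precomp (offIndex_injective n)

/-! ### Arbitrary systems and the conclusion -/

/-- The off-periods of the chain, indexed by the distance from the rightmost node. -/
noncomputable def extendOff {n : ℕ} (x : Fin n × ℕ → ℝ) (p : ℕ × ℕ) : ℝ :=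
  if h : p.1 < n then x (⟨n - 1 - p.1, by omega⟩, p.2) else 0

lemma measurable_extendOff {n : ℕ} : Measurable (extendOff (n := n)) := by
  refine measurable_pi_lambda _ fun p => ?_
  unfold extendOff
  split_ifs <;> fun_prop

lemma extendOff_apply {n : ℕ} (x : Fin n × ℕ → ℝ) (i : Fin n) (k : ℕ) :
    extendOff x (n - 1 - i, k) = x (i, k) := by
  have h : n - 1 - (i : ℕ) < n := by omega
  rw [extendOff, dif_pos h]
  congr 2
  exact Fin.ext (by simp only; omega)

/-- The law of the first reception of the leftmost node. -/
lemma IsPermanentOnOffSystem.hasLaw_firstReception {n : ℕ} [NeZero n] {Ω : Type*}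
    [MeasurableSpace Ω] {P : Measure Ω} {R S : Fin n → ℕ → Ω → ℝ}
    (h : IsPermanentOnOffSystem (fun _ => 1) P R S) :
    HasLaw (firstReception S) (gapLaw (n - 1)) P := by
  have := h.isProbabilityMeasure
  refine ⟨h.aemeasurable_reception 0 1, ?_⟩
  set X : Ω → Fin n × ℕ → ℝ := fun ω p => R p.1 p.2 ω - S p.1 p.2 ω with hX
  set H : (Fin n × ℕ → ℝ) → ℝ := fun x => gaps (n - 1) (extendOff x) 0 with hH
  have hHm : Measurable H :=
    (measurable_pi_apply 0).comp ((measurable_gaps (n - 1)).comp measurable_extendOff)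
  have hXlaw : HasLaw X (Measure.infinitePi fun _ : Fin n × ℕ => expMeasure 1) P :=
    iIndepFun.hasLaw_infinitePi (fun p => h.law_off p.1 p.2) h.indep_off
      (aemeasurable_pi_iff.2 fun p => (h.law_off p.1 p.2).aemeasurable)
  -- The dynamics determine the first reception from the off-periods, whose joint law is prescribed;
  -- its law is therefore that of the canonical chain.
  have hae : firstReception S =ᵐ[P] H ∘ X := by
    filter_upwards [h.path] with ω hω
    exact hω.reception_one fun i k => extendOff_apply (X ω) i k
  have hcanon : Measure.infinitePi (fun _ : Fin n × ℕ => expMeasure 1) =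
      offMeasure.map fun y p => y (n - 1 - (p.1 : ℕ), p.2) :=
    (Measure.map_infinitePi_infinitePi_of_inj (P := fun _ : ℕ × ℕ => expMeasure 1)
      (offIndex_injective n)).symm
  -- The value `0` that `extendOff` gives to rows from `n` on is harmless, as `gaps (n - 1)` does
  -- not see them.
  have hHy : (H ∘ fun (y : ℕ × ℕ → ℝ) (p : Fin n × ℕ) => y (n - 1 - (p.1 : ℕ), p.2)) =
      (fun d : ℕ → ℝ => d 0) ∘ gaps (n - 1) := by
    funext y
    refine congrFun (gaps_congr fun l hl k => ?_) 0
    have hn := NeZero.pos n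
    have hl' : l < n := by omega
    rw [extendOff, dif_pos hl']
    simp only
    congr 2
    omega
  rw [Measure.map_congr hae, ← AEMeasurable.map_map_of_aemeasurable hHm.aemeasurable
    hXlaw.aemeasurable, hXlaw.map_eq, hcanon, Measure.map_map hHm (by fun_prop), hHy,
    ← Measure.map_map (measurable_pi_apply 0) (measurable_gaps _), map_gaps,
    Measure.infinitePi_map_eval]

lemma IsPermanentOnOffSystem.integrable_firstReception {n : ℕ} [NeZero n] {Ω : Type*}
    [MeasurableSpace Ω] {P : Measure Ω} {R S : Fin n → ℕ → Ω → ℝ}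
    (h : IsPermanentOnOffSystem (fun _ => 1) P R S) :
    Integrable (firstReception S) P ∧ ∫ ω, firstReception S ω ∂P =
      Real.exp (∑ i ∈ Finset.range (n - 1), betaIntegral i 1) := by
  have hlaw := h.hasLaw_firstReception
  have hpos : ∀ᵐ ω ∂P, 0 ≤ firstReception S ω := by
    have h1 := ae_gapLaw_pos (n - 1)
    rw [← hlaw.map_eq] at h1
    exact (ae_of_ae_map hlaw.aemeasurable h1).mono fun ω hω => hω.le
  have hlin : ∫⁻ ω, ENNReal.ofReal (firstReception S ω) ∂P =
      ENNReal.ofReal (Real.exp (∑ i ∈ Finset.range (n - 1), betaIntegral i 1)) := by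
    rw [← lintegral_gapLaw, ← hlaw.map_eq,
      lintegral_map' ENNReal.measurable_ofReal.aemeasurable hlaw.aemeasurable]
  have hsm := hlaw.aemeasurable.aestronglyMeasurable
  refine ⟨⟨hsm, (hasFiniteIntegral_iff_ofReal hpos).2 (hlin ▸ ENNReal.ofReal_lt_top)⟩, ?_⟩
  rw [integral_eq_lintegral_of_nonneg_ae hpos hsm, hlin,
    ENNReal.toReal_ofReal (Real.exp_pos _).le]

theorem mainTheorem3 :
    ∃ C₁ C₂ : ℝ, 0 < C₁ ∧ 0 < C₂ ∧ ∀ (n : ℕ) [NeZero n], 2 ≤ n →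
      (∃ (Ω : Type) (_ : MeasurableSpace Ω) (P : Measure Ω) (R S : Fin n → ℕ → Ω → ℝ),
        IsPermanentOnOffSystem (fun _ => 1) P R S) ∧
      ∀ (Ω : Type*) [MeasurableSpace Ω] (P : Measure Ω) (R S : Fin n → ℕ → Ω → ℝ),
        IsPermanentOnOffSystem (fun _ => 1) P R S →
          Integrable (firstReception S) P ∧
          C₁ < (∫ ω, firstReception S ω ∂P) / Real.log n ∧
          (∫ ω, firstReception S ω ∂P) / Real.log n < C₂ := by
  have hl2 : 0 < Real.log 2 := Real.log_pos one_lt_two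
  refine ⟨1, Real.exp 2 * (1 + 2 / Real.log 2) + 1, one_pos, by positivity, fun n _ hn =>
    ⟨⟨_, _, _, _, _, isPermanentOnOffSystem_gaps n⟩, fun Ω _ P R S h => ?_⟩⟩
  obtain ⟨hint, hE⟩ := h.integrable_firstReception
  rw [hE]
  exact ⟨hint, exp_sum_betaIntegral_bounds hn⟩
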